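/- Let $n>1$ be an integer and let $f,g\in C_0^\infty(\mathbb R^n)$ be real-valued (smooth with compact support). There is a constant $C$, depending only on $f$, $g$ and $n$, such that the following holds for the solution $v$ of the initial value problem $$v_{tt}-\Delta v=0 \ \text{ on } \mathbb R^n\times\mathbb R,\qquad v(x,0)=f(x),\quad v_t(x,0)=g(x)\quad (x\in\mathbb R^n),$$ i.e. for every $v\in C^2(\mathbb R^n\times\mathbb R)$ satisfying these equations. For all $x\in\mathbb R^n$ and $t\in\mathbb R$: if $n$ is odd, then $$|v(x,t)|\le C\,(1+|t|)^{-(n-1)/2};$$ if $n$ is even, then $$|v(x,t)|\le C\,(1+|t|)^{-(n-1)/2}\,\bigl(1+\bigl||t|-|x|\bigr|\bigr)^{-(n-1)/2}.$$ -/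

import Mathlib

/-- `v = v(x, t)` is a classical solution of the initial value problem for the wave equation on
`ℝⁿ × ℝ` (all times, positive and negative): `v` is jointly of class `C²`, `v_tt - Δ v = 0`
everywhere, `v(x, 0) = f(x)` and `v_t(x, 0) = g(x)`. The Laplacian acts on the space variable. -/
structure IsWaveSolution {n : ℕ} (f g : EuclideanSpace ℝ (Fin n) → ℝ)
    (v : EuclideanSpace ℝ (Fin n) → ℝ → ℝ) : Prop where
  contDiff : ContDiff ℝ 2 (fun p : EuclideanSpace ℝ (Fin n) × ℝ => v p.1 p.2)
  wave : ∀ (x : EuclideanSpace ℝ (Fin n)) (t : ℝ),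
    iteratedDeriv 2 (fun s : ℝ => v x s) t
      - Laplacian.laplacian (fun y : EuclideanSpace ℝ (Fin n) => v y t) x = 0
  init : ∀ x : EuclideanSpace ℝ (Fin n), v x 0 = f x
  init_deriv : ∀ x : EuclideanSpace ℝ (Fin n), deriv (fun s : ℝ => v x s) 0 = g x

/-!
# Uniform decay of solutions of the wave equation

In every dimension `n ≥ 2` a solution with smooth compactly supported data satisfies
`|v(x, t)| ≤ C (1 + |t|)^{-(n-1)/2} (1 + ||t| - |x||)^{-(n-1)/2}`; no distinction between odd and
even `n` is needed, and for odd `n` the second factor is simply discarded.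

*Finite speed of propagation.* The energy `v_t² + |∇v|²`, weighted by a smooth function supported in
a backward light cone, is nonincreasing in time, because the weight decreases in time at least as
fast as its space gradient is large. Hence `v(x, t) = 0` when `|x| > |t| + R`, if the data are
supported in the ball of radius `R` (`IsWaveSolution.eq_zero_of_lt_norm`). The argument uses only
that `v` is `C²`, so it applies to every solution in the statement.

*Representation.* The slices `v(·, t)` now have compact support, so the spatial Fourier transform
satisfies `w'' = -(2π|ξ|)² w` and is determined by the data (`IsWaveSolution.fourier_eq`). Fourier
inversion writes `v` as a sum of half-waves `∫ e^{2πi(⟨x, ξ⟩ ± t|ξ|)} φ(ξ) |ξ|^{-j} dξ` with `φ`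
Schwartz, `j = 0` for the first datum and `j = 1` for the second
(`IsWaveSolution.eq_integral_halfWave`).

*Decay.* In polar coordinates `ξ = ρω`, the radial integral has phase `2πρ(⟨x, ω⟩ ± t)` and a weight
`ρ^{n-1-j}` that vanishes at the end point. Integration by parts `n - j` times bounds it by a
multiple of `(1 + |⟨x, ω⟩ ± t|)^{-(n-1)}` (`SchwartzMap.exists_norm_radial_integral_le`). It remains
to integrate this over the sphere. Let `D = 1 + ||t| - |x||` and let `ω'` be the part of `ω`
orthogonal to `x`. For `|x| ≤ |t| + R` one has
`1 + |⟨x, ω⟩ ± t| ≥ c (D + (1 + |t|) |ω'|²)` up to the sign of `ω`, and comparison of the sphere with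
the ball and then with a slab bounds the spherical integral by
`C ∫_{ℝ^{n-1}} (D + (1 + |t|) |z|²)^{-(n-1)} dz`, which scales to `C' (D (1 + |t|))^{-(n-1)/2}`
(`exists_integral_sphere_le`).
-/

open MeasureTheory Set Filter Topology
open scoped FourierTransform

/-! ### Partial derivatives on space-time and integrals over time slices -/

section PartialDerivatives

variable {E G : Type*} [NormedAddCommGroup E] [NormedSpace ℝ E]
  [NormedAddCommGroup G] [NormedSpace ℝ G]

/-- The partial derivative in time of a function on space-time `E × ℝ`. -/
noncomputable def timeDeriv (F : E × ℝ → G) (p : E × ℝ) : G := fderiv ℝ F p (0, 1)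

/-- The directional derivative, along the space direction `w`, of a function on space-time
`E × ℝ`. -/
noncomputable def spaceDeriv (w : E) (F : E × ℝ → G) (p : E × ℝ) : G := fderiv ℝ F p (w, 0)

lemma hasDerivAt_timeDeriv {F : E × ℝ → G} (hF : ContDiff ℝ 1 F) (x : E) (t : ℝ) :
    HasDerivAt (fun s => F (x, s)) (timeDeriv F (x, t)) t := by
  have h := (hF.differentiable one_ne_zero (x, t)).hasFDerivAt
  have h2 : HasDerivAt (fun s : ℝ => (x, s)) ((0 : E), (1 : ℝ)) t :=
    (hasDerivAt_const t x).prodMk (hasDerivAt_id t)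
  exact h.comp_hasDerivAt t h2

lemma hasFDerivAt_slice {F : E × ℝ → G} (hF : ContDiff ℝ 1 F) (x : E) (t : ℝ) :
    HasFDerivAt (fun y => F (y, t))
      ((fderiv ℝ F (x, t)).comp (ContinuousLinearMap.inl ℝ E ℝ)) x := by
  have h := (hF.differentiable one_ne_zero (x, t)).hasFDerivAt
  have h2 : HasFDerivAt (fun y : E => (y, t)) (ContinuousLinearMap.inl ℝ E ℝ) x :=
    hasFDerivAt_prodMk_left x t
  exact h.comp x h2

lemma hasLineDerivAt_spaceDeriv {F : E × ℝ → G} (hF : ContDiff ℝ 1 F) (w x : E) (t : ℝ) :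
    HasLineDerivAt ℝ (fun y => F (y, t)) (spaceDeriv w F (x, t)) x w := by
  simpa [spaceDeriv] using (hasFDerivAt_slice hF x t).hasLineDerivAt w

lemma fderiv_slice_apply {F : E × ℝ → G} (hF : ContDiff ℝ 1 F) (w x : E) (t : ℝ) :
    fderiv ℝ (fun y => F (y, t)) x w = spaceDeriv w F (x, t) := by
  rw [(hasFDerivAt_slice hF x t).fderiv]
  simp [spaceDeriv]

lemma ContDiff.timeDeriv {F : E × ℝ → G} (hF : ContDiff ℝ 2 F) : ContDiff ℝ 1 (timeDeriv F) :=
  (hF.fderiv_right (by norm_num)).clm_apply contDiff_const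

lemma ContDiff.spaceDeriv {F : E × ℝ → G} (hF : ContDiff ℝ 2 F) (w : E) :
    ContDiff ℝ 1 (spaceDeriv w F) :=
  (hF.fderiv_right (by norm_num)).clm_apply contDiff_const

lemma ContDiff.continuous_timeDeriv {F : E × ℝ → G} (hF : ContDiff ℝ 1 F) :
    Continuous (_root_.timeDeriv F) :=
  (hF.continuous_fderiv one_ne_zero).clm_apply continuous_const

lemma ContDiff.continuous_spaceDeriv {F : E × ℝ → G} (hF : ContDiff ℝ 1 F) (w : E) :
    Continuous (_root_.spaceDeriv w F) :=
  (hF.continuous_fderiv one_ne_zero).clm_apply continuous_const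

lemma timeDeriv_spaceDeriv {F : E × ℝ → G} (hF : ContDiff ℝ 2 F) (w : E) (p : E × ℝ) :
    timeDeriv (spaceDeriv w F) p = spaceDeriv w (timeDeriv F) p := by
  have hd : DifferentiableAt ℝ (fderiv ℝ F) p :=
    (hF.fderiv_right (m := 1) (by norm_num)).differentiable one_ne_zero p
  have h1 (u : E × ℝ) : HasFDerivAt (fun q => fderiv ℝ F q u)
      ((fderiv ℝ (fderiv ℝ F) p).flip u) p := by
    simpa using! hd.hasFDerivAt.clm_apply (hasFDerivAt_const u p)
  have hs : IsSymmSndFDerivAt ℝ F p :=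
    hF.contDiffAt.isSymmSndFDerivAt (by simp)
  change fderiv ℝ (fun q => fderiv ℝ F q (w, 0)) p (0, 1)
    = fderiv ℝ (fun q => fderiv ℝ F q (0, 1)) p (w, 0)
  rw [(h1 _).fderiv, (h1 _).fderiv]
  exact hs.eq _ _

lemma timeDeriv_eq_zero_of_eventually {F : E × ℝ → G} {x : E} {t : ℝ}
    (h : ∀ᶠ s in 𝓝 t, F (x, s) = 0) (hF : ContDiff ℝ 1 F) : timeDeriv F (x, t) = 0 := by
  have h1 := hasDerivAt_timeDeriv hF x t
  have h2 : HasDerivAt (fun s => F (x, s)) 0 t :=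
    (hasDerivAt_const t (0 : G)).congr_of_eventuallyEq h
  exact h1.unique h2

lemma spaceDeriv_eq_zero_of_support {F : E × ℝ → G} (hF : ContDiff ℝ 1 F) (w : E) {t r : ℝ}
    (h : ∀ x, r < ‖x‖ → F (x, t) = 0) {x : E} (hx : r < ‖x‖) : spaceDeriv w F (x, t) = 0 := by
  have h2 : (fun y => F (y, t)) =ᶠ[𝓝 x] fun _ => 0 := by
    filter_upwards [continuous_norm.continuousAt.eventually (lt_mem_nhds hx)] with y hy
    exact h y hy
  rw [← fderiv_slice_apply hF, h2.fderiv_eq]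
  simp

end PartialDerivatives

section Integrals

lemma integrable_of_continuous_of_support {E G : Type*} [NormedAddCommGroup E] [ProperSpace E]
    [MeasurableSpace E] [BorelSpace E] [NormedAddCommGroup G] {μ : Measure E}
    [IsFiniteMeasureOnCompacts μ] {F : E → G} (hF : Continuous F) {r : ℝ}
    (h : ∀ x, r < ‖x‖ → F x = 0) : Integrable F μ :=
  hF.integrable_of_hasCompactSupport <|
    HasCompactSupport.intro (isCompact_closedBall (0 : E) r) fun x hx => h x (by simpa using hx)

variable {E G : Type*} [NormedAddCommGroup E] [NormedSpace ℝ E] [FiniteDimensional ℝ E]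
  [MeasurableSpace E] [BorelSpace E] [NormedAddCommGroup G] [NormedSpace ℝ G]
  {μ : Measure E} [μ.IsAddHaarMeasure]

/-- Differentiation under the integral sign for a `C¹` function whose time slices near `t` are
supported in a common ball. -/
theorem hasDerivAt_integral_slice {F : E × ℝ → G} (hF : ContDiff ℝ 1 F) {t r : ℝ}
    (h : ∀ᶠ s in 𝓝 t, ∀ x, r < ‖x‖ → F (x, s) = 0) :
    HasDerivAt (fun s => ∫ x, F (x, s) ∂μ) (∫ x, timeDeriv F (x, t) ∂μ) t := by
  obtain ⟨δ, hδ, hball⟩ := Metric.eventually_nhds_iff_ball.1 h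
  have hK : IsCompact (Metric.closedBall (0 : E) r ×ˢ Metric.closedBall t δ) :=
    (isCompact_closedBall _ _).prod (isCompact_closedBall _ _)
  obtain ⟨M, hM⟩ := hK.exists_bound_of_continuousOn hF.continuous_timeDeriv.continuousOn
  have hcont (s : ℝ) : Continuous fun x => F (x, s) := by
    have := hF.continuous
    fun_prop
  refine (hasDerivAt_integral_of_dominated_loc_of_deriv_le (𝕜 := ℝ)
    (s := Metric.ball t δ) (F := fun s x => F (x, s)) (F' := fun s x => timeDeriv F (x, s))
    (bound := (Metric.closedBall (0 : E) r).indicator fun _ => M)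
    (Metric.ball_mem_nhds t hδ) ?_ ?_ ?_ ?_ ?_ ?_).2
  · exact Eventually.of_forall fun s => (hcont s).aestronglyMeasurable
  · exact integrable_of_continuous_of_support (hcont t) (h.self_of_nhds)
  · have := hF.continuous_timeDeriv
    exact (by fun_prop : Continuous fun x => timeDeriv F (x, t)).aestronglyMeasurable
  · refine Eventually.of_forall fun x s hs => ?_
    by_cases hx : x ∈ Metric.closedBall (0 : E) r
    · rw [indicator_of_mem hx]
      exact hM (x, s) ⟨hx, Metric.ball_subset_closedBall hs⟩
    · rw [indicator_of_notMem hx, timeDeriv_eq_zero_of_eventually _ hF, norm_zero]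
      filter_upwards [Metric.isOpen_ball.mem_nhds hs] with s' hs'
      exact hball s' hs' x (by simpa using hx)
  · exact (integrable_indicator_iff Metric.isClosed_closedBall.measurableSet).2
      (integrableOn_const (isCompact_closedBall _ _).measure_lt_top.ne)
  · exact Eventually.of_forall fun x s _ => hasDerivAt_timeDeriv hF x s

/-- The integral over space of a space derivative vanishes, for a compactly supported slice. -/
theorem integral_spaceDeriv_eq_zero {F : E × ℝ → G} (hF : ContDiff ℝ 1 F) {t r : ℝ} (w : E)
    (h : ∀ x, r < ‖x‖ → F (x, t) = 0) : ∫ x, spaceDeriv w F (x, t) ∂μ = 0 := by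
  have hF1 : Integrable (fun x => F (x, t)) μ :=
    integrable_of_continuous_of_support (by have := hF.continuous; fun_prop) h
  have hF2 : Integrable (fun x => spaceDeriv w F (x, t)) μ :=
    integrable_of_continuous_of_support (r := r)
      (by have := hF.continuous_spaceDeriv w; fun_prop) fun x hx =>
        spaceDeriv_eq_zero_of_support hF w h hx
  have := integral_bilinear_hasLineDerivAt_right_eq_neg_left_of_integrable (μ := μ)
    (f := fun _ : E => (1 : ℝ)) (f' := fun _ => 0) (g := fun x => F (x, t))
    (g' := fun x => spaceDeriv w F (x, t)) (v := w) (B := ContinuousLinearMap.lsmul ℝ ℝ)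
    (by simp) (by simpa using hF2) (by simpa using hF1)
    (fun x _ => by simpa using (hasFDerivAt_const (𝕜 := ℝ) (1 : ℝ) x).hasLineDerivAt w)
    (fun x _ => hasLineDerivAt_spaceDeriv hF w x t)
  simpa using this

end Integrals

/-! ### Energy in a light cone and finite speed of propagation -/

section FiniteSpeed

variable {n : ℕ}

/-- The `i`-th standard basis vector of `ℝⁿ`. -/
noncomputable abbrev stdVec (i : Fin n) : EuclideanSpace ℝ (Fin n) := EuclideanSpace.single i 1

lemma inner_stdVec_right (x : EuclideanSpace ℝ (Fin n)) (i : Fin n) :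
    inner ℝ x (stdVec i) = x i := by
  simp [stdVec, EuclideanSpace.inner_single_right]

namespace IsWaveSolution

variable {f g : EuclideanSpace ℝ (Fin n) → ℝ} {v : EuclideanSpace ℝ (Fin n) → ℝ → ℝ}

/-- The wave equation as a first-order identity on space-time: the time derivative of `v_t` is the
divergence of the space gradient. -/
lemma timeDeriv_timeDeriv (hv : IsWaveSolution f g v) (x : EuclideanSpace ℝ (Fin n)) (t : ℝ) :
    timeDeriv (timeDeriv fun p : EuclideanSpace ℝ (Fin n) × ℝ => v p.1 p.2) (x, t)
      = ∑ i, spaceDeriv (stdVec i)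
          (spaceDeriv (stdVec i) fun p : EuclideanSpace ℝ (Fin n) × ℝ => v p.1 p.2) (x, t) := by
  have hV := hv.contDiff
  have hV1 : ContDiff ℝ 1 (fun p : EuclideanSpace ℝ (Fin n) × ℝ => v p.1 p.2) :=
    hV.of_le (by norm_num)
  have h := hv.wave x t
  rw [InnerProductSpace.laplacian_eq_iteratedFDeriv_orthonormalBasis _
    (EuclideanSpace.basisFun (Fin n) ℝ), iteratedDeriv_succ, iteratedDeriv_one] at h
  have h1 : deriv (fun s => v x s)
      = fun s => timeDeriv (fun p : EuclideanSpace ℝ (Fin n) × ℝ => v p.1 p.2) (x, s) :=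
    funext fun s => (hasDerivAt_timeDeriv hV1 x s).deriv
  rw [h1, (hasDerivAt_timeDeriv hV.timeDeriv x t).deriv, sub_eq_zero] at h
  rw [h]
  refine Finset.sum_congr rfl fun i _ => ?_
  rw [iteratedFDeriv_two_apply]
  have hs : ContDiff ℝ 2 fun y => v y t := hV.comp (contDiff_id.prodMk contDiff_const)
  have hd : DifferentiableAt ℝ (fderiv ℝ fun y => v y t) x :=
    (hs.fderiv_right (m := 1) (by norm_num)).differentiable one_ne_zero x
  have h2 : fderiv ℝ (fun y => fderiv ℝ (fun y => v y t) y (stdVec i)) x (stdVec i)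
      = fderiv ℝ (fderiv ℝ fun y => v y t) x (stdVec i) (stdVec i) := by
    rw [(hd.hasFDerivAt.clm_apply (hasFDerivAt_const _ x)).fderiv]
    simp
  have h3 : (fun y => fderiv ℝ (fun y => v y t) y (stdVec i)) = fun y => spaceDeriv (stdVec i)
      (fun p : EuclideanSpace ℝ (Fin n) × ℝ => v p.1 p.2) (y, t) :=
    funext fun y => fderiv_slice_apply hV1 _ y t
  simp only [EuclideanSpace.basisFun_apply, Matrix.cons_val_zero, Matrix.cons_val_one]
  rw [← h2, h3, fderiv_slice_apply (hV.spaceDeriv _)]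

lemma timeDeriv_zero (hv : IsWaveSolution f g v) (x : EuclideanSpace ℝ (Fin n)) :
    timeDeriv (fun p : EuclideanSpace ℝ (Fin n) × ℝ => v p.1 p.2) (x, 0) = g x := by
  rw [← hv.init_deriv x]
  exact (hasDerivAt_timeDeriv (hv.contDiff.of_le (by norm_num)) x 0).deriv.symm

/-- Time reversal, which changes the sign of the initial velocity; it reduces negative times to
positive ones. -/
lemma reverse (hv : IsWaveSolution f g v) :
    IsWaveSolution f (fun x => -g x) (fun x t => v x (-t)) where
  contDiff := hv.contDiff.comp (contDiff_fst.prodMk contDiff_snd.neg)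
  wave x t := by
    rw [iteratedDeriv_comp_neg 2 (fun s => v x s) t]
    simpa using hv.wave x (-t)
  init x := by simpa using hv.init x
  init_deriv x := by
    rw [deriv_comp_neg (fun s => v x s) 0]
    simpa using hv.init_deriv x

end IsWaveSolution

lemma deriv_expNegInvGlue_nonneg (s : ℝ) : 0 ≤ deriv expNegInvGlue s :=
  expNegInvGlue.monotone.deriv_nonneg

lemma deriv_expNegInvGlue_of_nonpos {s : ℝ} (hs : s ≤ 0) : deriv expNegInvGlue s = 0 := by
  have : IsLocalMin expNegInvGlue s := Eventually.of_forall fun y => by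
    rw [expNegInvGlue.zero_of_nonpos hs]
    exact expNegInvGlue.nonneg y
  exact this.deriv_eq_zero

/-- A smooth weight supported in the light cone with vertex `(z, T)`. -/
noncomputable def coneWeight (z : EuclideanSpace ℝ (Fin n)) (T : ℝ)
    (p : EuclideanSpace ℝ (Fin n) × ℝ) : ℝ :=
  expNegInvGlue ((T - p.2) ^ 2 - ‖p.1 - z‖ ^ 2)

lemma contDiff_coneWeight (z : EuclideanSpace ℝ (Fin n)) (T : ℝ) :
    ContDiff ℝ 1 (coneWeight z T) := by
  have h : ContDiff ℝ 1 expNegInvGlue := expNegInvGlue.contDiff (n := 1)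
  refine h.comp ?_
  exact ((contDiff_const.sub contDiff_snd).pow 2).sub ((contDiff_fst.sub contDiff_const).norm_sq ℝ)

lemma coneWeight_nonneg (z : EuclideanSpace ℝ (Fin n)) (T : ℝ)
    (p : EuclideanSpace ℝ (Fin n) × ℝ) : 0 ≤ coneWeight z T p :=
  expNegInvGlue.nonneg _

lemma coneWeight_eq_zero {z : EuclideanSpace ℝ (Fin n)} {T : ℝ}
    {p : EuclideanSpace ℝ (Fin n) × ℝ} (h : |T - p.2| ≤ ‖p.1 - z‖) : coneWeight z T p = 0 := by
  refine expNegInvGlue.zero_of_nonpos ?_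
  have := sq_le_sq' (by linarith [abs_nonneg (T - p.2)]) h
  rw [sq_abs] at this
  linarith

lemma hasFDerivAt_coneArg (z x : EuclideanSpace ℝ (Fin n)) (T t : ℝ) :
    HasFDerivAt (fun p : EuclideanSpace ℝ (Fin n) × ℝ => (T - p.2) ^ 2 - ‖p.1 - z‖ ^ 2)
      ((-2 * (T - t)) • ContinuousLinearMap.snd ℝ _ ℝ
        - (2 : ℝ) • (innerSL ℝ (x - z)).comp (ContinuousLinearMap.fst ℝ _ ℝ)) (x, t) := by
  have h1 : HasFDerivAt (fun p : EuclideanSpace ℝ (Fin n) × ℝ => (T - p.2) ^ 2)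
      ((-2 * (T - t)) • ContinuousLinearMap.snd ℝ _ ℝ) (x, t) := by
    have := ((hasFDerivAt_const T (x, t)).sub
      (hasFDerivAt_snd (𝕜 := ℝ) (p := (x, t)))).pow 2
    refine this.congr_fderiv ?_
    ext <;> simp
  have h2 := ((hasFDerivAt_fst (𝕜 := ℝ) (p := (x, t))).sub (hasFDerivAt_const z (x, t))).norm_sq
  refine (h1.sub h2).congr_fderiv ?_
  ext <;> simp

lemma fderiv_coneWeight (z x w : EuclideanSpace ℝ (Fin n)) (T t s : ℝ) :
    fderiv ℝ (coneWeight z T) (x, t) (w, s)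
      = deriv expNegInvGlue ((T - t) ^ 2 - ‖x - z‖ ^ 2)
        * (-2 * (T - t) * s - 2 * inner ℝ (x - z) w) := by
  have hd : HasDerivAt expNegInvGlue (deriv expNegInvGlue ((T - t) ^ 2 - ‖x - z‖ ^ 2))
      ((T - t) ^ 2 - ‖x - z‖ ^ 2) :=
    ((expNegInvGlue.contDiff (n := 1)).differentiable (by simp) _).hasDerivAt
  have h := HasDerivAt.comp_hasFDerivAt (x, t) hd (hasFDerivAt_coneArg z x T t)
  have h' : HasFDerivAt (coneWeight z T) _ (x, t) := h
  rw [h'.fderiv]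
  simp [inner_sub_left]


lemma two_mul_le_of_sq_le {a b c r S : ℝ} (hb : 0 ≤ b) (hr : 0 ≤ r) (hrc : r ≤ c)
    (hS : S ^ 2 ≤ r ^ 2 * b) : 2 * a * S ≤ c * (a ^ 2 + b) := by
  have h1 : |S| ≤ r * √b := by
    refine abs_le_of_sq_le_sq ?_ (by positivity)
    rwa [mul_pow, Real.sq_sqrt hb]
  have h2 : a * S ≤ |a| * (r * √b) :=
    (le_abs_self _).trans (by rw [abs_mul]; gcongr)
  have h3 : 2 * |a| * √b ≤ a ^ 2 + b := by
    nlinarith [sq_nonneg (|a| - √b), Real.sq_sqrt hb, sq_abs a]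
  have h4 : 0 ≤ a ^ 2 + b := by positivity
  nlinarith [mul_le_mul_of_nonneg_right hrc h4, mul_le_mul_of_nonneg_left h3 hr]

/-- The energy density `v_t² + |∇v|²`, cut off smoothly to the light cone with vertex `(z, T)`. -/
noncomputable def coneEnergyDensity (v : EuclideanSpace ℝ (Fin n) → ℝ → ℝ)
    (z : EuclideanSpace ℝ (Fin n)) (T : ℝ) (p : EuclideanSpace ℝ (Fin n) × ℝ) : ℝ :=
  coneWeight z T p * (timeDeriv (fun q : EuclideanSpace ℝ (Fin n) × ℝ => v q.1 q.2) p ^ 2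
    + ∑ i, spaceDeriv (stdVec i) (fun q : EuclideanSpace ℝ (Fin n) × ℝ => v q.1 q.2) p ^ 2)

namespace IsWaveSolution

variable {f g : EuclideanSpace ℝ (Fin n) → ℝ} {v : EuclideanSpace ℝ (Fin n) → ℝ → ℝ}

lemma contDiff_coneEnergyDensity (hv : IsWaveSolution f g v) (z : EuclideanSpace ℝ (Fin n))
    (T : ℝ) : ContDiff ℝ 1 (coneEnergyDensity v z T) :=
  (contDiff_coneWeight z T).mul ((hv.contDiff.timeDeriv.pow 2).add
    (ContDiff.sum fun i _ => (hv.contDiff.spaceDeriv (stdVec i)).pow 2))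

/-- Inside the cone, the time derivative of the energy density is at most a divergence: the
remaining term has a sign because the cone closes up at unit speed. -/
lemma timeDeriv_coneEnergyDensity_le (hv : IsWaveSolution f g v)
    (z x : EuclideanSpace ℝ (Fin n)) {T t : ℝ} (ht : t ≤ T) :
    timeDeriv (coneEnergyDensity v z T) (x, t)
      ≤ ∑ i, spaceDeriv (stdVec i) (fun p => 2 * (coneWeight z T p
          * timeDeriv (fun q : EuclideanSpace ℝ (Fin n) × ℝ => v q.1 q.2) p
          * spaceDeriv (stdVec i) (fun q : EuclideanSpace ℝ (Fin n) × ℝ => v q.1 q.2) p))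
          (x, t) := by
  have hwave := hv.timeDeriv_timeDeriv x t
  have hA := hv.contDiff.timeDeriv
  have hB := fun i => hv.contDiff.spaceDeriv (stdVec i)
  have hsymm := fun i => timeDeriv_spaceDeriv hv.contDiff (stdVec i) (x, t)
  have hE := hv.contDiff_coneEnergyDensity z T
  have hφ := contDiff_coneWeight z T
  unfold coneEnergyDensity at hE ⊢
  set A := timeDeriv (fun q : EuclideanSpace ℝ (Fin n) × ℝ => v q.1 q.2)
  set B := fun i => spaceDeriv (stdVec i) (fun q : EuclideanSpace ℝ (Fin n) × ℝ => v q.1 q.2)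
  change ∀ i, ContDiff ℝ 1 (B i) at hB
  change timeDeriv A (x, t) = ∑ i, spaceDeriv (stdVec i) (B i) (x, t) at hwave
  change ∀ i, timeDeriv (B i) (x, t) = spaceDeriv (stdVec i) A (x, t) at hsymm
  change timeDeriv (fun p => coneWeight z T p * (A p ^ 2 + ∑ i, B i p ^ 2)) (x, t)
    ≤ ∑ i, spaceDeriv (stdVec i) (fun p => 2 * (coneWeight z T p * A p * B i p)) (x, t)
  have h1 : timeDeriv (fun p => coneWeight z T p * (A p ^ 2 + ∑ i, B i p ^ 2)) (x, t)
      = timeDeriv (coneWeight z T) (x, t) * (A (x, t) ^ 2 + ∑ i, B i (x, t) ^ 2)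
        + coneWeight z T (x, t) * (2 * A (x, t) * timeDeriv A (x, t)
          + ∑ i, 2 * B i (x, t) * timeDeriv (B i) (x, t)) := by
    have h := (hasDerivAt_timeDeriv hφ x t).mul (((hasDerivAt_timeDeriv hA x t).pow 2).add
      (HasDerivAt.fun_sum (u := Finset.univ) fun i _ => (hasDerivAt_timeDeriv (hB i) x t).pow 2))
    refine ((hasDerivAt_timeDeriv hE x t).unique h).trans ?_
    simp
  have h2 (i : Fin n) : spaceDeriv (stdVec i) (fun p => 2 * (coneWeight z T p * A p * B i p)) (x, t)
      = 2 * (spaceDeriv (stdVec i) (coneWeight z T) (x, t) * A (x, t) * B i (x, t)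
        + coneWeight z T (x, t) * spaceDeriv (stdVec i) A (x, t) * B i (x, t)
        + coneWeight z T (x, t) * A (x, t) * spaceDeriv (stdVec i) (B i) (x, t)) := by
    have d1 := (hφ.differentiable one_ne_zero (x, t)).hasFDerivAt
    have d2 := (hA.differentiable one_ne_zero (x, t)).hasFDerivAt
    have d3 := ((hB i).differentiable one_ne_zero (x, t)).hasFDerivAt
    have h := ((d1.fun_mul d2).fun_mul d3).const_mul 2
    rw [spaceDeriv, HasFDerivAt.fderiv h]
    simp [spaceDeriv]
    ring
  have h3 : timeDeriv (coneWeight z T) (x, t)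
      = deriv expNegInvGlue ((T - t) ^ 2 - ‖x - z‖ ^ 2) * (-2 * (T - t)) := by
    simp [timeDeriv, fderiv_coneWeight]
  have h4 (i : Fin n) : spaceDeriv (stdVec i) (coneWeight z T) (x, t)
      = deriv expNegInvGlue ((T - t) ^ 2 - ‖x - z‖ ^ 2) * (-2 * (x - z) i) := by
    simp [spaceDeriv, fderiv_coneWeight, inner_stdVec_right]
  simp only [h1, h2, h3, h4, hwave, hsymm]
  set ψ := deriv expNegInvGlue ((T - t) ^ 2 - ‖x - z‖ ^ 2) with hψ
  -- Cauchy–Schwarz; where `ψ ≠ 0` the point lies in the cone, so `‖x - z‖ ≤ T - t`.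
  have hkey : ψ * (2 * A (x, t) * (∑ i, (x - z) i * B i (x, t)))
      ≤ ψ * ((T - t) * (A (x, t) ^ 2 + ∑ i, B i (x, t) ^ 2)) := by
    rcases le_or_gt ((T - t) ^ 2 - ‖x - z‖ ^ 2) 0 with h | h
    · rw [hψ, deriv_expNegInvGlue_of_nonpos h]
      simp
    · refine mul_le_mul_of_nonneg_left ?_ (deriv_expNegInvGlue_nonneg _)
      refine two_mul_le_of_sq_le (Finset.sum_nonneg fun i _ => sq_nonneg _) (norm_nonneg (x - z))
        (abs_le_of_sq_le_sq' (by linarith) (by linarith)).2 ?_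
      rw [EuclideanSpace.real_norm_sq_eq]
      exact Finset.sum_mul_sq_le_sq_mul_sq _ _ _
  have h5 : ∑ i, 2 * (ψ * (-2 * (x - z) i) * A (x, t) * B i (x, t)
        + coneWeight z T (x, t) * spaceDeriv (stdVec i) A (x, t) * B i (x, t)
        + coneWeight z T (x, t) * A (x, t) * spaceDeriv (stdVec i) (B i) (x, t))
      = -2 * (ψ * (2 * A (x, t) * (∑ i, (x - z) i * B i (x, t))))
        + coneWeight z T (x, t) * (2 * A (x, t) * ∑ i, spaceDeriv (stdVec i) (B i) (x, t)
          + ∑ i, 2 * B i (x, t) * spaceDeriv (stdVec i) A (x, t)) := by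
    simp only [Finset.mul_sum, mul_add, ← Finset.sum_add_distrib]
    refine Finset.sum_congr rfl fun i _ => ?_
    ring
  rw [h5]
  linarith

/-- Domain of dependence: if the data vanish on the ball of radius `T` about `z`, the solution
vanishes at `(z, T)`. -/
theorem eq_zero_of_data_eq_zero (hv : IsWaveSolution f g v) {z : EuclideanSpace ℝ (Fin n)} {T : ℝ}
    (hT : 0 ≤ T) (hf : ∀ x, ‖x - z‖ ≤ T → f x = 0) (hg : ∀ x, ‖x - z‖ ≤ T → g x = 0) :
    v z T = 0 := by
  set V := fun q : EuclideanSpace ℝ (Fin n) × ℝ => v q.1 q.2 with hV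
  have hV1 : ContDiff ℝ 1 V := hv.contDiff.of_le (by norm_num)
  have hE := hv.contDiff_coneEnergyDensity z T
  have hsupp (s : ℝ) (x : EuclideanSpace ℝ (Fin n)) (hx : ‖z‖ + |T - s| < ‖x‖) :
      coneWeight z T (x, s) = 0 := by
    refine coneWeight_eq_zero ?_
    have := norm_sub_norm_le x z
    dsimp only
    linarith
  have hnonneg (p : EuclideanSpace ℝ (Fin n) × ℝ) : 0 ≤ coneEnergyDensity v z T p :=
    mul_nonneg (coneWeight_nonneg z T p)
      (add_nonneg (sq_nonneg _) (Finset.sum_nonneg fun i _ => sq_nonneg _))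
  have hderiv (t : ℝ) : HasDerivAt (fun s => ∫ x, coneEnergyDensity v z T (x, s))
      (∫ x, timeDeriv (coneEnergyDensity v z T) (x, t)) t := by
    refine hasDerivAt_integral_slice hE (r := ‖z‖ + (|T - t| + 1)) ?_
    have : ∀ᶠ s in 𝓝 t, |T - s| < |T - t| + 1 :=
      (by fun_prop : Continuous fun s : ℝ => |T - s|).continuousAt.eventually
        (gt_mem_nhds (by linarith))
    filter_upwards [this] with s hs x hx
    simp [coneEnergyDensity, hsupp s x (by linarith)]
  have hderiv_le (t : ℝ) (ht : t ≤ T) :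
      ∫ x, timeDeriv (coneEnergyDensity v z T) (x, t) ≤ 0 := by
    have hflux (i : Fin n) : ContDiff ℝ 1 fun p => 2 * (coneWeight z T p
        * timeDeriv V p * spaceDeriv (stdVec i) V p) :=
      contDiff_const.mul (((contDiff_coneWeight z T).mul hv.contDiff.timeDeriv).mul
        (hv.contDiff.spaceDeriv _))
    have hzero (i : Fin n) := integral_spaceDeriv_eq_zero (μ := volume) (hflux i) (stdVec i) (t := t)
      (r := ‖z‖ + |T - t|) (fun x hx => by simp [hsupp t x hx])
    have hint (i : Fin n) : Integrable fun x => spaceDeriv (stdVec i) (fun p => 2 * (coneWeight z T p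
        * timeDeriv V p * spaceDeriv (stdVec i) V p)) (x, t) :=
      integrable_of_continuous_of_support (r := ‖z‖ + |T - t|)
        (by have := (hflux i).continuous_spaceDeriv (stdVec i); fun_prop) fun x hx =>
          spaceDeriv_eq_zero_of_support (hflux i) _ (fun y hy => by simp [hsupp t y hy]) hx
    calc ∫ x, timeDeriv (coneEnergyDensity v z T) (x, t)
        ≤ ∫ x, ∑ i, spaceDeriv (stdVec i) (fun p => 2 * (coneWeight z T p
          * timeDeriv V p * spaceDeriv (stdVec i) V p)) (x, t) := by
          refine integral_mono ?_ (integrable_finsetSum _ fun i _ => hint i)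
            fun x => hv.timeDeriv_coneEnergyDensity_le z x ht
          refine integrable_of_continuous_of_support (r := ‖z‖ + (|T - t| + 1))
            (by have := hE.continuous_timeDeriv; fun_prop) fun x hx => ?_
          refine timeDeriv_eq_zero_of_eventually ?_ hE
          have : ∀ᶠ s in 𝓝 t, |T - s| < |T - t| + 1 :=
            (by fun_prop : Continuous fun s : ℝ => |T - s|).continuousAt.eventually
              (gt_mem_nhds (by linarith))
          filter_upwards [this] with s hs
          simp [coneEnergyDensity, hsupp s x (by linarith)]
      _ = 0 := by
          rw [integral_finsetSum _ fun i _ => hint i]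
          exact Finset.sum_eq_zero fun i _ => hzero i
  have hinit : ∫ x, coneEnergyDensity v z T (x, 0) = 0 := by
    refine integral_eq_zero_of_ae (Eventually.of_forall fun x => ?_)
    rcases le_or_gt T ‖x - z‖ with hx | hx
    · simp [coneEnergyDensity, coneWeight_eq_zero (z := z) (T := T) (p := (x, 0))
        (by simpa [abs_of_nonneg hT] using hx)]
    · have h1 (i : Fin n) : spaceDeriv (stdVec i) V (x, 0) = 0 := by
        rw [← fderiv_slice_apply hV1]
        have h2 : (fun y => V (y, 0)) =ᶠ[𝓝 x] fun _ => 0 := by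
          have : ∀ᶠ y in 𝓝 x, ‖y - z‖ < T :=
            (by fun_prop : Continuous fun y => ‖y - z‖).continuousAt.eventually (gt_mem_nhds hx)
          filter_upwards [this] with y hy
          simp [hV, hv.init, hf y hy.le]
        rw [h2.fderiv_eq]
        simp
      have h2 : timeDeriv V (x, 0) = 0 := by rw [hV, hv.timeDeriv_zero, hg x hx.le]
      have : coneEnergyDensity v z T (x, 0) = coneWeight z T (x, 0)
          * (timeDeriv V (x, 0) ^ 2 + ∑ i, spaceDeriv (stdVec i) V (x, 0) ^ 2) := rfl
      simp [this, h1, h2]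
  have hanti : AntitoneOn (fun s => ∫ x, coneEnergyDensity v z T (x, s)) (Icc 0 T) := by
    refine antitoneOn_of_deriv_nonpos (convex_Icc 0 T)
      (fun s _ => (hderiv s).continuousAt.continuousWithinAt)
      (fun s _ => (hderiv s).differentiableAt.differentiableWithinAt) fun s hs => ?_
    rw [interior_Icc] at hs
    rw [(hderiv s).deriv]
    exact hderiv_le s hs.2.le
  -- The energy vanishes up to time `T`, hence so does its density, and the weight is positive on
  -- the axis of the cone.
  have hvt (t : ℝ) (ht : t ∈ Ico 0 T) : timeDeriv V (z, t) = 0 := by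
    have h1 : ∫ x, coneEnergyDensity v z T (x, t) ≤ 0 :=
      hinit ▸ hanti ⟨le_rfl, hT⟩ ⟨ht.1, ht.2.le⟩ ht.1
    have hc : Continuous fun x => coneEnergyDensity v z T (x, t) := by
      have := hE.continuous
      fun_prop
    have h2 : coneEnergyDensity v z T (z, t) = 0 := by
      by_contra hne
      refine absurd (hc.integral_pos_of_hasCompactSupport_nonneg_nonzero (μ := volume) ?_
        (fun x => hnonneg _) hne) (not_lt.2 h1)
      refine HasCompactSupport.intro (isCompact_closedBall 0 (‖z‖ + |T - t|)) fun x hx => ?_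
      simp [coneEnergyDensity, hsupp t x (by simpa using hx)]
    have h3 : 0 < coneWeight z T (z, t) := by
      refine expNegInvGlue.pos_of_pos ?_
      simpa using pow_pos (sub_pos.2 ht.2) 2
    have h4 := (mul_eq_zero.1 h2).resolve_left h3.ne'
    have h5 := (add_eq_zero_iff_of_nonneg (sq_nonneg _)
      (Finset.sum_nonneg fun i _ => sq_nonneg _)).1 h4
    exact pow_eq_zero_iff two_ne_zero |>.1 h5.1
  have hconst := constant_of_has_deriv_right_zero (f := fun s => V (z, s)) (a := 0) (b := T)
    (fun s _ => (hasDerivAt_timeDeriv hV1 z s).continuousAt.continuousWithinAt)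
    (fun s hs => by
      have := (hasDerivAt_timeDeriv hV1 z s).hasDerivWithinAt (s := Ici s)
      rwa [hvt s hs] at this) T ⟨hT, le_rfl⟩
  have h0 : V (z, 0) = 0 := by
    simp only [hV, hv.init]
    exact hf z (by simpa using hT)
  exact hconst.trans h0

/-- Finite speed of propagation: data supported in the ball of radius `R` give a solution supported
in `|x| ≤ R + |t|`, for times of both signs. -/
theorem eq_zero_of_lt_norm (hv : IsWaveSolution f g v) {R : ℝ} (hf : ∀ x, R < ‖x‖ → f x = 0)
    (hg : ∀ x, R < ‖x‖ → g x = 0) {x : EuclideanSpace ℝ (Fin n)} {t : ℝ} (hx : R + |t| < ‖x‖) :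
    v x t = 0 := by
  have hfar (y : EuclideanSpace ℝ (Fin n)) (hy : ‖y - x‖ ≤ |t|) : R < ‖y‖ := by
    have := norm_sub_norm_le x y
    rw [norm_sub_rev] at this
    linarith
  rcases le_total 0 t with ht | ht
  · rw [abs_of_nonneg ht] at hfar
    exact hv.eq_zero_of_data_eq_zero ht (fun y hy => hf y (hfar y hy))
      fun y hy => hg y (hfar y hy)
  · rw [abs_of_nonpos ht] at hfar
    have := hv.reverse.eq_zero_of_data_eq_zero (T := -t) (z := x) (by linarith)
      (fun y hy => hf y (hfar y hy)) fun y hy => by simp [hg y (hfar y hy)]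
    simpa using this

end IsWaveSolution

end FiniteSpeed

/-! ### The spatial Fourier transform of a solution -/

section HarmonicOscillator

/-- The solution of `w'' = -k² w`, as a superposition of `e^{ikt}` and `e^{-ikt}`. -/
lemma eq_of_hasDerivAt_oscillator {k : ℝ} (hk : k ≠ 0) {w w' : ℝ → ℂ}
    (h1 : ∀ t, HasDerivAt w (w' t) t) (h2 : ∀ t, HasDerivAt w' (-(k : ℂ) ^ 2 * w t) t) (t : ℝ) :
    w t = (Complex.exp (k * t * Complex.I) * (w 0 + w' 0 / (k * Complex.I))
      + Complex.exp (-(k * t * Complex.I)) * (w 0 - w' 0 / (k * Complex.I))) / 2 := by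
  -- `e^{-ckt} (w' + c k w)` is constant for `c = ±i`.
  have key (c : ℂ) (hc : c ^ 2 = -1) :
      Complex.exp (-(k * t * c)) * (w' t + k * c * w t) = w' 0 + k * c * w 0 := by
    have hd (s : ℝ) : HasDerivAt
        (fun s : ℝ => Complex.exp (-(k * s * c)) * (w' s + k * c * w s)) 0 s := by
      have he : HasDerivAt (fun s : ℝ => Complex.exp (-(k * s * c)))
          (Complex.exp (-(k * s * c)) * -(k * 1 * c)) s :=
        ((((Complex.ofRealCLM.hasDerivAt (x := s)).const_mul (k : ℂ)).mul_const c).neg).cexp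
      refine (he.mul ((h2 s).fun_add ((h1 s).const_mul (k * c)))).congr_deriv ?_
      linear_combination (-(k : ℂ) ^ 2 * w s * Complex.exp (-(k * s * c))) * hc
    have := is_const_of_deriv_eq_zero (fun s => (hd s).differentiableAt)
      (fun s => (hd s).deriv) t 0
    simpa using this
  have hp := key Complex.I (by simp)
  have hm := key (-Complex.I) (by simp)
  have hk' : (k : ℂ) ≠ 0 := by exact_mod_cast hk
  have e1 : Complex.exp (k * t * Complex.I) * Complex.exp (-(k * t * Complex.I)) = 1 := by
    rw [← Complex.exp_add]; simp
  rw [show -((k : ℂ) * t * -Complex.I) = k * t * Complex.I by ring] at hm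
  field_simp
  linear_combination Complex.exp (k * t * Complex.I) * hp
    - Complex.exp (-(k * t * Complex.I)) * hm - (2 * k * Complex.I * w t) * e1

end HarmonicOscillator

section FourierRepresentation

variable {n : ℕ}

/-- A function on space-time multiplied by the character `x ↦ e^{-2πi⟨x, ξ⟩}`; its integral over
space is the partial Fourier transform at `ξ`. -/
noncomputable def charMul (ξ : EuclideanSpace ℝ (Fin n))
    (h : EuclideanSpace ℝ (Fin n) × ℝ → ℝ) (p : EuclideanSpace ℝ (Fin n) × ℝ) : ℂ :=
  Complex.exp (((-2 * Real.pi * inner ℝ p.1 ξ : ℝ) : ℂ) * Complex.I) * (h p : ℂ)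

lemma ContDiff.charMul {m : ℕ∞} (ξ : EuclideanSpace ℝ (Fin n))
    {h : EuclideanSpace ℝ (Fin n) × ℝ → ℝ} (hh : ContDiff ℝ m h) :
    ContDiff ℝ m (charMul ξ h) := by
  refine ContDiff.mul ?_ (Complex.ofRealCLM.contDiff.comp hh)
  refine ContDiff.cexp (ContDiff.mul (Complex.ofRealCLM.contDiff.comp ?_) contDiff_const)
  exact contDiff_const.mul (contDiff_fst.inner ℝ contDiff_const)

lemma fderiv_charMul (ξ : EuclideanSpace ℝ (Fin n))
    {h : EuclideanSpace ℝ (Fin n) × ℝ → ℝ} (hh : ContDiff ℝ 1 h)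
    (p q : EuclideanSpace ℝ (Fin n) × ℝ) :
    fderiv ℝ (charMul ξ h) p q = Complex.exp (((-2 * Real.pi * inner ℝ p.1 ξ : ℝ) : ℂ) * Complex.I)
        * (fderiv ℝ h p q : ℂ)
      - 2 * Real.pi * Complex.I * (inner ℝ q.1 ξ : ℝ) * charMul ξ h p := by
  have d1 : HasFDerivAt (fun p : EuclideanSpace ℝ (Fin n) × ℝ => -2 * Real.pi * inner ℝ p.1 ξ)
      ((-2 * Real.pi) • (innerSL ℝ ξ).comp (ContinuousLinearMap.fst ℝ _ ℝ)) p := by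
    have h0 : HasFDerivAt (fun p : EuclideanSpace ℝ (Fin n) × ℝ => inner ℝ ξ p.1)
        ((innerSL ℝ ξ).comp (ContinuousLinearMap.fst ℝ _ ℝ)) p :=
      ((innerSL ℝ ξ).comp (ContinuousLinearMap.fst ℝ _ ℝ)).hasFDerivAt
    simpa only [real_inner_comm] using h0.const_mul (-2 * Real.pi)
  have d2 := ((Complex.ofRealCLM.hasFDerivAt.comp p d1).mul_const Complex.I).cexp
  have d3 := Complex.ofRealCLM.hasFDerivAt.comp p
    (hh.differentiable one_ne_zero p).hasFDerivAt
  have d4 : HasFDerivAt (charMul ξ h) _ p := d2.mul d3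
  rw [d4.fderiv]
  simp [charMul, real_inner_comm]
  ring

lemma timeDeriv_charMul (ξ : EuclideanSpace ℝ (Fin n))
    {h : EuclideanSpace ℝ (Fin n) × ℝ → ℝ} (hh : ContDiff ℝ 1 h) :
    timeDeriv (charMul ξ h) = charMul ξ (timeDeriv h) := by
  funext p
  rw [timeDeriv, fderiv_charMul ξ hh]
  simp [charMul, timeDeriv]

lemma charMul_spaceDeriv (ξ : EuclideanSpace ℝ (Fin n))
    {h : EuclideanSpace ℝ (Fin n) × ℝ → ℝ} (hh : ContDiff ℝ 1 h) (i : Fin n)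
    (p : EuclideanSpace ℝ (Fin n) × ℝ) :
    charMul ξ (spaceDeriv (stdVec i) h) p = spaceDeriv (stdVec i) (charMul ξ h) p
      + 2 * Real.pi * Complex.I * ξ i * charMul ξ h p := by
  rw [spaceDeriv, fderiv_charMul ξ hh]
  simp only [real_inner_comm ξ (stdVec i), inner_stdVec_right]
  rw [charMul, spaceDeriv]
  ring

lemma integral_charMul_spaceDeriv (ξ : EuclideanSpace ℝ (Fin n))
    {h : EuclideanSpace ℝ (Fin n) × ℝ → ℝ} (hh : ContDiff ℝ 1 h) (i : Fin n) {t r : ℝ}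
    (hr : ∀ x, r < ‖x‖ → h (x, t) = 0) :
    ∫ x, charMul ξ (spaceDeriv (stdVec i) h) (x, t)
      = 2 * Real.pi * Complex.I * ξ i * ∫ x, charMul ξ h (x, t) := by
  have hc : ContDiff ℝ 1 (charMul ξ h) := ContDiff.charMul (m := 1) ξ hh
  have hr' (x : EuclideanSpace ℝ (Fin n)) (hx : r < ‖x‖) : charMul ξ h (x, t) = 0 := by
    simp [charMul, hr x hx]
  have hi : Integrable fun x => charMul ξ h (x, t) :=
    integrable_of_continuous_of_support (by have := hc.continuous; fun_prop) hr'
  have hi2 : Integrable fun x => spaceDeriv (stdVec i) (charMul ξ h) (x, t) :=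
    integrable_of_continuous_of_support (r := r)
      (by have := hc.continuous_spaceDeriv (stdVec i); fun_prop)
      fun x hx => spaceDeriv_eq_zero_of_support hc _ hr' hx
  simp only [charMul_spaceDeriv ξ hh]
  rw [integral_add hi2 (hi.const_mul _), integral_spaceDeriv_eq_zero hc _ hr', integral_const_mul,
    zero_add]

namespace IsWaveSolution

variable {f g : EuclideanSpace ℝ (Fin n) → ℝ} {v : EuclideanSpace ℝ (Fin n) → ℝ → ℝ}

/-- The spatial Fourier transform of a solution with compactly supported data. -/
theorem fourier_eq (hv : IsWaveSolution f g v) {R : ℝ} (hf : ∀ x, R < ‖x‖ → f x = 0)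
    (hg : ∀ x, R < ‖x‖ → g x = 0) {ξ : EuclideanSpace ℝ (Fin n)} (hξ : ξ ≠ 0) (t : ℝ) :
    𝓕 (fun x => (v x t : ℂ)) ξ
      = (Complex.exp ((2 * Real.pi * ‖ξ‖ : ℝ) * t * Complex.I) * (𝓕 (fun x => (f x : ℂ)) ξ
          + 𝓕 (fun x => (g x : ℂ)) ξ / ((2 * Real.pi * ‖ξ‖ : ℝ) * Complex.I))
        + Complex.exp (-((2 * Real.pi * ‖ξ‖ : ℝ) * t * Complex.I)) * (𝓕 (fun x => (f x : ℂ)) ξ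
          - 𝓕 (fun x => (g x : ℂ)) ξ / ((2 * Real.pi * ‖ξ‖ : ℝ) * Complex.I))) / 2 := by
  set V := fun q : EuclideanSpace ℝ (Fin n) × ℝ => v q.1 q.2 with hV
  have hV2 : ContDiff ℝ 2 V := hv.contDiff
  have hV1 : ContDiff ℝ 1 V := hV2.of_le (by norm_num)
  have hVs (t : ℝ) (x : EuclideanSpace ℝ (Fin n)) (hx : R + |t| < ‖x‖) : V (x, t) = 0 :=
    hv.eq_zero_of_lt_norm hf hg hx
  have hnear (t : ℝ) : ∀ᶠ s in 𝓝 t, |s| < |t| + 1 :=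
    continuous_abs.continuousAt.eventually (gt_mem_nhds (by linarith))
  have hAs (t : ℝ) (x : EuclideanSpace ℝ (Fin n)) (hx : R + |t| < ‖x‖) :
      timeDeriv V (x, t) = 0 := by
    refine timeDeriv_eq_zero_of_eventually ?_ hV1
    have : ∀ᶠ s in 𝓝 t, R + |s| < ‖x‖ :=
      (by fun_prop : Continuous fun s : ℝ => R + |s|).continuousAt.eventually (gt_mem_nhds hx)
    filter_upwards [this] with s hs using hVs s x hs
  have hBs (i : Fin n) (t : ℝ) (x : EuclideanSpace ℝ (Fin n)) (hx : R + |t| < ‖x‖) :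
      spaceDeriv (stdVec i) V (x, t) = 0 :=
    spaceDeriv_eq_zero_of_support hV1 _ (hVs t) hx
  have d1 (t : ℝ) : HasDerivAt (fun s => ∫ x, charMul ξ V (x, s))
      (∫ x, charMul ξ (timeDeriv V) (x, t)) t := by
    rw [← timeDeriv_charMul ξ hV1]
    refine hasDerivAt_integral_slice (ContDiff.charMul (m := 1) ξ hV1) (r := R + (|t| + 1)) ?_
    filter_upwards [hnear t] with s hs x hx
    simp [charMul, hVs s x (by linarith)]
  have d2 (t : ℝ) : HasDerivAt (fun s => ∫ x, charMul ξ (timeDeriv V) (x, s))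
      (-((2 * Real.pi * ‖ξ‖ : ℝ) : ℂ) ^ 2 * ∫ x, charMul ξ V (x, t)) t := by
    have h1 : HasDerivAt (fun s => ∫ x, charMul ξ (timeDeriv V) (x, s))
        (∫ x, timeDeriv (charMul ξ (timeDeriv V)) (x, t)) t := by
      refine hasDerivAt_integral_slice (ContDiff.charMul (m := 1) ξ hV2.timeDeriv)
        (r := R + (|t| + 1)) ?_
      filter_upwards [hnear t] with s hs x hx
      simp [charMul, hAs s x (by linarith)]
    refine h1.congr_deriv ?_
    have hB := fun i => hV2.spaceDeriv (stdVec i)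
    have h2 (x : EuclideanSpace ℝ (Fin n)) : timeDeriv (charMul ξ (timeDeriv V)) (x, t)
        = ∑ i, charMul ξ (spaceDeriv (stdVec i) (spaceDeriv (stdVec i) V)) (x, t) := by
      rw [timeDeriv_charMul ξ hV2.timeDeriv, charMul, hv.timeDeriv_timeDeriv x t]
      rw [Complex.ofReal_sum, Finset.mul_sum]
      rfl
    simp only [h2]
    rw [integral_finsetSum]
    · simp only [fun i => integral_charMul_spaceDeriv ξ (hB i) i (hBs i t),
        fun i => integral_charMul_spaceDeriv ξ hV1 i (hVs t)]
      have h3 : ((‖ξ‖ : ℝ) : ℂ) ^ 2 = ∑ i, (ξ i : ℂ) ^ 2 := by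
        exact_mod_cast congrArg (fun r : ℝ => (r : ℂ)) (EuclideanSpace.real_norm_sq_eq ξ)
      push_cast
      rw [mul_pow, mul_pow, h3, Finset.mul_sum, ← Finset.sum_neg_distrib, Finset.sum_mul]
      refine Finset.sum_congr rfl fun i _ => ?_
      linear_combination (2 ^ 2 * (Real.pi : ℂ) ^ 2 * ξ i ^ 2 * ∫ x, charMul ξ V (x, t))
        * Complex.I_sq
    · intro i _
      refine integrable_of_continuous_of_support (r := R + |t|) ?_ fun x hx => ?_
      · have := (hB i).continuous_spaceDeriv (stdVec i)
        have h4 : Continuous (charMul ξ (spaceDeriv (stdVec i) (spaceDeriv (stdVec i) V))) := by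
          unfold charMul
          fun_prop
        fun_prop
      · simp [charMul, spaceDeriv_eq_zero_of_support (hB i) (stdVec i) (hBs i t) hx]
  have hk : 2 * Real.pi * ‖ξ‖ ≠ 0 := by
    have := norm_ne_zero_iff.2 hξ
    positivity
  have hsol := eq_of_hasDerivAt_oscillator hk d1 d2 t
  have e1 : ∫ x, charMul ξ V (x, t) = 𝓕 (fun x => (v x t : ℂ)) ξ := by
    rw [Real.fourier_eq']; rfl
  have e2 : ∫ x, charMul ξ V (x, 0) = 𝓕 (fun x => (f x : ℂ)) ξ := by
    rw [Real.fourier_eq']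
    simp only [charMul, hV, hv.init]
    rfl
  have e3 : ∫ x, charMul ξ (timeDeriv V) (x, 0) = 𝓕 (fun x => (g x : ℂ)) ξ := by
    rw [Real.fourier_eq']
    simp only [charMul, hV, hv.timeDeriv_zero]
    rfl
  rwa [e1, e2, e3] at hsol

end IsWaveSolution

end FourierRepresentation

/-! ### Oscillatory integrals on a half-line -/

section OscillatoryIntegral

/-- An amplitude `a 0` with its successive derivatives `a 1, a 2, …`, such that `a 0, …, a k` are
bounded by `A (1 + ρ)^{-(M + 2)}` on the half-line `ρ ≥ 0`. The exponent leaves room for a weight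
`ρ ^ m` with `m ≤ M`. -/
structure IsDecayingAmplitude (M k : ℕ) (A : ℝ) (a : ℕ → ℝ → ℂ) : Prop where
  hasDerivAt : ∀ j ρ, HasDerivAt (a j) (a (j + 1) ρ) ρ
  bound : ∀ j ≤ k, ∀ ρ, 0 ≤ ρ → (1 + ρ) ^ (M + 2) * ‖a j ρ‖ ≤ A

namespace IsDecayingAmplitude

variable {M k : ℕ} {A : ℝ} {a : ℕ → ℝ → ℂ}

lemma nonneg (h : IsDecayingAmplitude M k A a) : 0 ≤ A :=
  (by positivity : (0 : ℝ) ≤ (1 + 0) ^ (M + 2) * ‖a 0 0‖).trans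
    (h.bound 0 (Nat.zero_le _) 0 le_rfl)

lemma of_le (h : IsDecayingAmplitude M k A a) {l : ℕ} (hl : l ≤ k) :
    IsDecayingAmplitude M l A a :=
  ⟨h.hasDerivAt, fun j hj => h.bound j (hj.trans hl)⟩

lemma shift (h : IsDecayingAmplitude M (k + 1) A a) :
    IsDecayingAmplitude M k A fun j => a (j + 1) :=
  ⟨fun j => h.hasDerivAt (j + 1), fun j hj => h.bound (j + 1) (by omega)⟩

lemma norm_le (h : IsDecayingAmplitude M k A a) {m : ℕ} (hm : m ≤ M) (s : ℝ) {ρ : ℝ}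
    (hρ : 0 ≤ ρ) :
    ‖Complex.exp (ρ * s * Complex.I) * ρ ^ m * a 0 ρ‖ ≤ A * (1 + ρ ^ 2)⁻¹ := by
  have h1 : ‖Complex.exp (ρ * s * Complex.I)‖ = 1 := by
    exact_mod_cast Complex.norm_exp_ofReal_mul_I (ρ * s)
  rw [norm_mul, norm_mul, h1, one_mul, norm_pow, Complex.norm_real, Real.norm_of_nonneg hρ,
    ← div_eq_mul_inv, le_div_iff₀ (by positivity)]
  refine le_trans ?_ (h.bound 0 (Nat.zero_le _) ρ hρ)
  have h2 : ρ ^ m ≤ (1 + ρ) ^ M :=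
    (pow_le_pow_left₀ hρ (by linarith) m).trans (pow_le_pow_right₀ (by linarith) hm)
  have h3 : 1 + ρ ^ 2 ≤ (1 + ρ) ^ 2 := by nlinarith
  calc ρ ^ m * ‖a 0 ρ‖ * (1 + ρ ^ 2) = ρ ^ m * (1 + ρ ^ 2) * ‖a 0 ρ‖ := by ring
    _ ≤ (1 + ρ) ^ M * (1 + ρ) ^ 2 * ‖a 0 ρ‖ := by gcongr
    _ = _ := by rw [pow_add]

lemma integrableOn (h : IsDecayingAmplitude M k A a) {m : ℕ} (hm : m ≤ M) (s : ℝ) :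
    IntegrableOn (fun ρ : ℝ => Complex.exp (ρ * s * Complex.I) * ρ ^ m * a 0 ρ) (Ioi 0) := by
  refine Integrable.mono' (integrable_inv_one_add_sq.const_mul A).integrableOn ?_ ?_
  · have : Continuous (a 0) := continuous_iff_continuousAt.2 fun ρ => (h.hasDerivAt 0 ρ).continuousAt
    exact (by fun_prop : Continuous fun ρ : ℝ =>
      Complex.exp (ρ * s * Complex.I) * ρ ^ m * a 0 ρ).aestronglyMeasurable
  · exact (ae_restrict_mem measurableSet_Ioi).mono fun ρ hρ => h.norm_le hm s (le_of_lt hρ)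

lemma norm_integral_le (h : IsDecayingAmplitude M k A a) {m : ℕ} (hm : m ≤ M) (s : ℝ) :
    ‖∫ ρ in Ioi (0 : ℝ), Complex.exp (ρ * s * Complex.I) * ρ ^ m * a 0 ρ‖ ≤ 2 * A := by
  have h1 := norm_integral_le_of_norm_le
    (integrable_inv_one_add_sq.const_mul A).integrableOn
    ((ae_restrict_mem measurableSet_Ioi).mono fun ρ hρ => h.norm_le hm s (le_of_lt hρ))
  refine h1.trans ?_
  rw [integral_const_mul, integral_Ioi_inv_one_add_sq]
  nlinarith [h.nonneg, Real.pi_le_four, Real.arctan_zero]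

/-- Integration by parts in the oscillatory integral; the boundary term at `0` survives only when
no power of `ρ` is present. -/
lemma mul_integral_eq (h : IsDecayingAmplitude M (k + 1) A a) {m : ℕ} (hm : m ≤ M) (s : ℝ) :
    s * Complex.I * ∫ ρ in Ioi (0 : ℝ), Complex.exp (ρ * s * Complex.I) * ρ ^ m * a 0 ρ
      = -(0 ^ m * a 0 0)
        - m * (∫ ρ in Ioi (0 : ℝ), Complex.exp (ρ * s * Complex.I) * ρ ^ (m - 1) * a 0 ρ)
        - ∫ ρ in Ioi (0 : ℝ), Complex.exp (ρ * s * Complex.I) * ρ ^ m * a 1 ρ := by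
  have hd (ρ : ℝ) : HasDerivAt
      (fun ρ : ℝ => Complex.exp (ρ * s * Complex.I) * ρ ^ m * a 0 ρ)
      (s * Complex.I * (Complex.exp (ρ * s * Complex.I) * ρ ^ m * a 0 ρ)
        + m * (Complex.exp (ρ * s * Complex.I) * ρ ^ (m - 1) * a 0 ρ)
        + Complex.exp (ρ * s * Complex.I) * ρ ^ m * a 1 ρ) ρ := by
    have h1 : HasDerivAt (fun ρ : ℝ => (ρ : ℂ)) 1 ρ := Complex.ofRealCLM.hasDerivAt
    refine (((((h1.mul_const (s : ℂ)).mul_const Complex.I).cexp).fun_mul (h1.fun_pow m)).fun_mul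
      (h.hasDerivAt 0 ρ)).congr_deriv ?_
    ring
  have i1 := (h.integrableOn hm s).const_mul (s * Complex.I)
  have i2 := (h.integrableOn ((Nat.sub_le m 1).trans hm) s).const_mul (m : ℂ)
  have i3 : IntegrableOn (fun ρ : ℝ => Complex.exp (ρ * s * Complex.I) * ρ ^ m * a 1 ρ) (Ioi 0) :=
    h.shift.integrableOn hm s
  have hint := (i1.fun_add i2).fun_add i3
  have hftc := integral_Ioi_of_hasDerivAt_of_tendsto (hd 0).continuousAt.continuousWithinAt
    (fun ρ _ => hd ρ) hint
    (tendsto_zero_of_hasDerivAt_of_integrableOn_Ioi (fun ρ _ => hd ρ) hint (h.integrableOn hm s))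
  rw [integral_add (i1.fun_add i2) i3, integral_add i1 i2, integral_const_mul, integral_const_mul]
    at hftc
  simp only [Complex.ofReal_zero, zero_mul, Complex.exp_zero, one_mul, zero_sub] at hftc
  linear_combination hftc

/-- Repeated integration by parts. Each step either lowers the power of `ρ` or differentiates the
amplitude, and it can be repeated until the boundary term at `0` appears, that is `m + 1` times. -/
lemma pow_mul_norm_integral_le (k : ℕ) : ∀ {A : ℝ} {a : ℕ → ℝ → ℂ},
    IsDecayingAmplitude M k A a → ∀ {m : ℕ}, m ≤ M → k ≤ m + 1 → ∀ s : ℝ,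
    |s| ^ k * ‖∫ ρ in Ioi (0 : ℝ), Complex.exp (ρ * s * Complex.I) * ρ ^ m * a 0 ρ‖
      ≤ 2 * (M + 2) ^ k * A := by
  induction k with
  | zero => intro A a h m hm _ s; simpa using h.norm_integral_le hm s
  | succ k ih =>
    intro A a h m hm hk s
    have hA := h.nonneg
    have hM : (1 : ℝ) ≤ (M + 2) ^ k := one_le_pow₀ (by linarith [(Nat.cast_nonneg M : (0 : ℝ) ≤ M)])
    have h1 := congrArg norm (h.mul_integral_eq hm s)
    rw [norm_mul, norm_mul, Complex.norm_I, mul_one, Complex.norm_real, Real.norm_eq_abs] at h1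
    have h3 := ih h.shift hm (by omega) s
    rw [pow_succ, mul_assoc, h1]
    rcases m with _ | m
    · have hk0 : k = 0 := by omega
      subst hk0
      have h0 : ‖a 0 0‖ ≤ A := by simpa using h.bound 0 (Nat.zero_le _) 0 le_rfl
      have h2 := norm_sub_le (-(a 0 0))
        (∫ ρ in Ioi (0 : ℝ), Complex.exp (ρ * s * Complex.I) * ρ ^ 0 * a 1 ρ)
      rw [norm_neg] at h2
      simp only [pow_zero, one_mul, Nat.cast_zero, zero_mul, sub_zero, zero_add, pow_one] at h2 h3 ⊢
      nlinarith [mul_nonneg (Nat.cast_nonneg M : (0 : ℝ) ≤ M) hA]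
    · have h2 := ih (h.of_le (Nat.le_succ k)) (m := m) (by omega) (by omega) s
      simp only [zero_pow (Nat.succ_ne_zero m), zero_mul, neg_zero, zero_sub, Nat.add_sub_cancel]
      have hmM : ((m + 1 : ℕ) : ℝ) ≤ M := by exact_mod_cast hm
      calc _ ≤ |s| ^ k * (((m + 1 : ℕ) : ℝ)
              * ‖∫ ρ in Ioi (0 : ℝ), Complex.exp (ρ * s * Complex.I) * ρ ^ m * a 0 ρ‖
            + ‖∫ ρ in Ioi (0 : ℝ), Complex.exp (ρ * s * Complex.I) * ρ ^ (m + 1) * a 1 ρ‖) := by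
            gcongr
            refine (norm_sub_le _ _).trans_eq ?_
            rw [norm_neg, norm_mul, Complex.norm_natCast]
        _ = ((m + 1 : ℕ) : ℝ) * (|s| ^ k
              * ‖∫ ρ in Ioi (0 : ℝ), Complex.exp (ρ * s * Complex.I) * ρ ^ m * a 0 ρ‖)
            + |s| ^ k
              * ‖∫ ρ in Ioi (0 : ℝ), Complex.exp (ρ * s * Complex.I) * ρ ^ (m + 1) * a 1 ρ‖ := by
            ring
        _ ≤ (M : ℝ) * (2 * (M + 2) ^ k * A) + 2 * (M + 2) ^ k * A := by gcongr
        _ ≤ 2 * (M + 2) ^ (k + 1) * A := by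
            rw [pow_succ]
            nlinarith [mul_nonneg (zero_le_one.trans hM) hA]

/-- An amplitude with `m` powers of `ρ` at the end point produces the decay
`(1 + |s|)^{-(m + 1)}`. -/
lemma norm_integral_le_pow {m : ℕ} (h : IsDecayingAmplitude m (m + 1) A a) (s : ℝ) :
    ‖∫ ρ in Ioi (0 : ℝ), Complex.exp (ρ * s * Complex.I) * ρ ^ m * a 0 ρ‖
      ≤ 2 ^ m * (2 + 2 * (m + 2) ^ (m + 1)) * A * ((1 + |s|) ^ (m + 1))⁻¹ := by
  have h0 := h.norm_integral_le le_rfl s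
  have h1 := pow_mul_norm_integral_le (m + 1) h le_rfl le_rfl s
  have h2 := add_pow_le zero_le_one (abs_nonneg s) (m + 1)
  rw [one_pow, Nat.add_sub_cancel] at h2
  rw [← div_eq_mul_inv, le_div_iff₀ (by positivity)]
  set N := ‖∫ ρ in Ioi (0 : ℝ), Complex.exp (ρ * s * Complex.I) * ρ ^ m * a 0 ρ‖
  calc N * (1 + |s|) ^ (m + 1) ≤ N * (2 ^ m * (1 + |s| ^ (m + 1))) := by gcongr
    _ = 2 ^ m * (N + |s| ^ (m + 1) * N) := by ring
    _ ≤ 2 ^ m * (2 * A + 2 * (m + 2) ^ (m + 1) * A) := by gcongr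
    _ = _ := by ring

end IsDecayingAmplitude

variable {E : Type*} [NormedAddCommGroup E] [NormedSpace ℝ E]

/-- The restriction of a Schwartz function to a ray is a decaying amplitude, uniformly in the
direction of the ray. -/
lemma SchwartzMap.exists_isDecayingAmplitude (φ : SchwartzMap E ℂ) (M k : ℕ) :
    ∃ A, ∀ ω : E, ‖ω‖ = 1 → IsDecayingAmplitude M k A
      fun j ρ => iteratedFDeriv ℝ j φ (ρ • ω) fun _ => ω := by
  refine ⟨2 ^ (M + 2) * ((Finset.Iic (M + 2, k)).sup fun l => SchwartzMap.seminorm ℝ l.1 l.2) φ,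
    fun ω hω => ⟨fun j ρ => ?_, fun j hj ρ hρ => ?_⟩⟩
  · have h1 : HasFDerivAt (iteratedFDeriv ℝ j φ) (fderiv ℝ (iteratedFDeriv ℝ j φ) (ρ • ω))
        (ρ • ω) :=
      (((φ.smooth (j + 1 : ℕ)).differentiable_iteratedFDeriv
        (by exact_mod_cast Nat.lt_succ_self j)) _).hasFDerivAt
    have h2 : HasDerivAt (fun ρ : ℝ => ρ • ω) ω ρ := by
      simpa using (hasDerivAt_id ρ).smul_const ω
    have h3 := h1.comp_hasDerivAt ρ h2
    have h4 := (ContinuousMultilinearMap.apply ℝ (fun _ : Fin j => E) ℂ fun _ => ω).hasFDerivAt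
      |>.comp_hasDerivAt ρ h3
    refine h4.congr_deriv ?_
    rw [iteratedFDeriv_succ_apply_left]
    rfl
  · have h1 := φ.one_add_le_sup_seminorm_apply (𝕜 := ℝ) (m := (M + 2, k)) le_rfl hj (ρ • ω)
    rw [norm_smul, hω, mul_one, Real.norm_of_nonneg hρ] at h1
    refine le_trans ?_ h1
    gcongr
    refine (ContinuousMultilinearMap.le_opNorm _ _).trans_eq ?_
    simp [hω]

/-- Decay of the Fourier transform in the radial variable of a Schwartz function with weight
`ρ ^ m`. -/
theorem SchwartzMap.exists_norm_radial_integral_le (φ : SchwartzMap E ℂ) (m : ℕ) :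
    ∃ C, 0 ≤ C ∧ ∀ ω : E, ‖ω‖ = 1 → ∀ s : ℝ,
      ‖∫ ρ in Ioi (0 : ℝ), Complex.exp (ρ * s * Complex.I) * ρ ^ m * φ (ρ • ω)‖
        ≤ C * ((1 + |s|) ^ (m + 1))⁻¹ := by
  obtain ⟨A, hA⟩ := φ.exists_isDecayingAmplitude m (m + 1)
  refine ⟨2 ^ m * (2 + 2 * (m + 2) ^ (m + 1)) * |A|, by positivity, fun ω hω s => ?_⟩
  have h := (hA ω hω).norm_integral_le_pow s
  rw [abs_of_nonneg (hA ω hω).nonneg]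
  simpa using h

end OscillatoryIntegral

/-! ### Polar coordinates and the integral over the sphere -/

section PolarCoordinates

variable {E F : Type*} [NormedAddCommGroup E] [NormedSpace ℝ E] [FiniteDimensional ℝ E]
  [MeasurableSpace E] [BorelSpace E] [Nontrivial E] [NormedAddCommGroup F] [NormedSpace ℝ F]

/-- Polar coordinates for the integral of a vector-valued function. -/
theorem integral_eq_integral_sphere (μ : Measure E) [μ.IsAddHaarMeasure] {f : E → F}
    (hf : Integrable f μ) :
    Integrable (fun ω : Metric.sphere (0 : E) 1 =>
        ∫ ρ in Ioi (0 : ℝ), ρ ^ (Module.finrank ℝ E - 1) • f (ρ • ω.1)) μ.toSphere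
      ∧ ∫ x, f x ∂μ = ∫ ω : Metric.sphere (0 : E) 1,
        (∫ ρ in Ioi (0 : ℝ), ρ ^ (Module.finrank ℝ E - 1) • f (ρ • ω.1)) ∂μ.toSphere := by
  set g : Metric.sphere (0 : E) 1 × Ioi (0 : ℝ) → F := fun p => f (p.2.1 • p.1.1) with hg
  have hgf (x : ({0}ᶜ : Set E)) : g (homeomorphUnitSphereProd E x) = f x.1 := by
    have hx : ‖x.1‖ ≠ 0 := norm_ne_zero_iff.2 x.2
    simp [hg, smul_smul, hx]
  have hmp := μ.measurePreserving_homeomorphUnitSphereProd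
  have hemb := (homeomorphUnitSphereProd E).measurableEmbedding
  have hint : Integrable g (μ.toSphere.prod (.volumeIoiPow (Module.finrank ℝ E - 1))) := by
    rw [← hmp.integrable_comp_emb hemb, show g ∘ homeomorphUnitSphereProd E = f ∘ Subtype.val from
      funext hgf, ← integrableOn_iff_comap_subtypeVal (measurableSet_singleton _).compl]
    exact hf.integrableOn
  have hinner (ω : Metric.sphere (0 : E) 1) :
      ∫ ρ, g (ω, ρ) ∂(Measure.volumeIoiPow (Module.finrank ℝ E - 1))
        = ∫ ρ in Ioi (0 : ℝ), ρ ^ (Module.finrank ℝ E - 1) • f (ρ • ω.1) := by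
    simp only [Measure.volumeIoiPow, ENNReal.ofReal]
    rw [integral_withDensity_eq_integral_smul,
      integral_subtype_comap measurableSet_Ioi
        fun a => Real.toNNReal (a ^ (Module.finrank ℝ E - 1)) • f (a • ω.1)]
    · refine setIntegral_congr_fun measurableSet_Ioi fun x hx => ?_
      rw [NNReal.smul_def, Real.coe_toNNReal _ (pow_nonneg (le_of_lt hx) _)]
    · exact (measurable_subtype_coe.pow_const _).real_toNNReal
  simp only [← hinner]
  refine ⟨hint.integral_prod_left, ?_⟩
  rw [← integral_prod _ hint, ← hmp.integral_comp hemb]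
  simp only [hgf]
  rw [integral_subtype_comap (measurableSet_singleton _).compl f, restrict_compl_singleton]

lemma integrable_sphere_of_continuous {E F : Type*} [NormedAddCommGroup E] [NormedSpace ℝ E]
    [FiniteDimensional ℝ E] [MeasurableSpace E] [BorelSpace E] [NormedAddCommGroup F]
    (μ : Measure E) [μ.IsAddHaarMeasure]
    {f : Metric.sphere (0 : E) 1 → F} (hf : Continuous f) : Integrable f μ.toSphere :=
  hf.integrable_of_hasCompactSupport (HasCompactSupport.of_compactSpace f)

/-- The integral over the unit sphere of a function that decreases along rays is controlled by its
integral over the unit ball. -/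
theorem integral_sphere_le_integral_ball (μ : Measure E) [μ.IsAddHaarMeasure] {h : E → ℝ}
    (hc : Continuous h)
    (hmono : ∀ ω : E, ∀ ρ : ℝ, 0 < ρ → ρ < 1 → h ω ≤ h (ρ • ω)) :
    ∫ ω : Metric.sphere (0 : E) 1, h ω ∂μ.toSphere
      ≤ Module.finrank ℝ E * ∫ x in Metric.ball (0 : E) 1, h x ∂μ := by
  have hint : Integrable ((Metric.ball (0 : E) 1).indicator h) μ := by
    rw [integrable_indicator_iff Metric.isOpen_ball.measurableSet]
    exact (hc.continuousOn.integrableOn_compact (isCompact_closedBall (0 : E) 1)).mono_set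
      Metric.ball_subset_closedBall
  obtain ⟨hi, he⟩ := integral_eq_integral_sphere μ hint
  have hpos : (0 : ℝ) < Module.finrank ℝ E := by exact_mod_cast Module.finrank_pos
  rw [← integral_indicator Metric.isOpen_ball.measurableSet, he, ← div_le_iff₀' hpos,
    ← integral_div]
  refine integral_mono
    ((integrable_sphere_of_continuous μ (hc.comp continuous_subtype_val)).div_const _) hi
    fun ω => ?_
  have hω : ‖ω.1‖ = 1 := by simp
  have h1 : ∫ ρ in Ioi (0 : ℝ), ρ ^ (Module.finrank ℝ E - 1)
        • (Metric.ball (0 : E) 1).indicator h (ρ • ω.1)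
      = ∫ ρ in Ioo (0 : ℝ) 1, ρ ^ (Module.finrank ℝ E - 1) * h (ρ • ω.1) := by
    rw [← integral_indicator measurableSet_Ioi, ← integral_indicator measurableSet_Ioo]
    congr 1
    funext ρ
    by_cases h0 : 0 < ρ
    · by_cases h2 : ρ < 1
      · simp [indicator, h0, h2, norm_smul, hω, abs_of_pos h0]
      · simp [indicator, h0, h2, norm_smul, hω, abs_of_pos h0]
    · simp [indicator, h0]
  have h2 : ∫ ρ in Ioo (0 : ℝ) 1, ρ ^ (Module.finrank ℝ E - 1) * h ω.1
      = h ω.1 / Module.finrank ℝ E := by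
    rw [integral_mul_const, ← integral_Ioc_eq_integral_Ioo,
      ← intervalIntegral.integral_of_le zero_le_one, integral_pow,
      Nat.sub_add_cancel Module.finrank_pos, ← Nat.cast_succ, Nat.succ_eq_add_one,
      Nat.sub_add_cancel Module.finrank_pos]
    simp [Module.finrank_pos.ne']
    ring
  simp only
  rw [h1, ← h2]
  have hio {u : ℝ → ℝ} (hu : Continuous u) : IntegrableOn u (Ioo 0 1) :=
    (hu.continuousOn.integrableOn_compact isCompact_Icc).mono_set Ioo_subset_Icc_self
  refine setIntegral_mono_on (hio (by fun_prop)) (hio (by fun_prop)) measurableSet_Ioo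
    fun ρ hρ => ?_
  have := hρ.1.le
  gcongr
  exact hmono _ _ hρ.1 hρ.2

end PolarCoordinates

section SphereEstimate

/-- Coordinates on `ℝ^{m+1}` adapted to a unit vector `e`: the component along `e` and `m`
orthogonal components, the latter measured in the sup norm. -/
lemma exists_orthogonal_coordinates {m : ℕ} (e : EuclideanSpace ℝ (Fin (m + 1))) (he : ‖e‖ = 1) :
    ∃ Z : EuclideanSpace ℝ (Fin (m + 1)) →L[ℝ] (Fin m → ℝ),
      (∀ y, ‖Z y‖ ^ 2 ≤ ‖y‖ ^ 2 - (inner ℝ e y) ^ 2) ∧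
      MeasurePreserving fun y => ((inner ℝ e y : ℝ), Z y) := by
  have ho : Orthonormal ℝ (({0} : Set (Fin (m + 1))).domRestrict fun _ => e) := by
    refine ⟨fun i => he, fun i j hij => absurd (Subsingleton.elim i j) hij⟩
  obtain ⟨b, hb⟩ := ho.exists_orthonormalBasis_extension_of_card_eq (by simp)
  have hb0 : b 0 = e := hb 0 rfl
  refine ⟨ContinuousLinearMap.pi fun i => innerSL ℝ (b i.succ), fun y => ?_, ?_⟩
  · have h1 : ‖y‖ ^ 2 = ∑ i, (inner ℝ (b i) y) ^ 2 := (b.sum_sq_inner_right y).symm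
    rw [h1, Fin.sum_univ_succ, hb0, add_sub_cancel_left]
    have h2 (i : Fin m) : |inner ℝ (b i.succ) y| ≤ √(∑ i : Fin m, (inner ℝ (b i.succ) y) ^ 2) :=
      Real.abs_le_sqrt (Finset.single_le_sum (f := fun i : Fin m => (inner ℝ (b i.succ) y) ^ 2)
        (fun i _ => sq_nonneg _) (Finset.mem_univ i))
    have h3 := (pi_norm_le_iff_of_nonneg (x := (ContinuousLinearMap.pi fun i : Fin m =>
      innerSL ℝ (b i.succ)) y) (Real.sqrt_nonneg _)).2 h2
    exact (pow_le_pow_left₀ (norm_nonneg _) h3 2).trans_eq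
      (Real.sq_sqrt (Finset.sum_nonneg fun i _ => sq_nonneg _))
  · have h := ((volume_preserving_piFinSuccAbove (fun _ : Fin (m + 1) => ℝ) 0).comp
      (PiLp.volume_preserving_ofLp (Fin (m + 1)))).comp b.measurePreserving_repr
    refine (congrArg (fun φ => MeasurePreserving φ volume volume) (funext fun y => ?_)).mp h
    refine Prod.ext ?_ (funext fun i => ?_)
    · simp [MeasurableEquiv.piFinSuccAbove, Fin.insertNthEquiv, b.repr_apply_apply, hb0]
    · simp [MeasurableEquiv.piFinSuccAbove, Fin.insertNthEquiv, b.repr_apply_apply, Fin.tail]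

lemma integrable_inv_one_add_norm_sq_pow {m : ℕ} (hm : 1 ≤ m) :
    Integrable fun u : Fin m → ℝ => ((1 + ‖u‖ ^ 2) ^ m)⁻¹ := by
  have h := integrable_rpow_neg_one_add_norm_sq (E := Fin m → ℝ) (μ := volume) (r := 2 * m)
    (by simp; linarith [(by exact_mod_cast hm : (1 : ℝ) ≤ m)])
  refine h.congr (Eventually.of_forall fun u => ?_)
  simp only
  rw [show -(2 * (m : ℝ)) / 2 = -m by ring, Real.rpow_neg (by positivity), Real.rpow_natCast]

lemma inv_pow_add_eq {m : ℕ} {D τ : ℝ} (hD : 0 < D) (hτ : 0 < τ) (z : Fin m → ℝ) :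
    ((D + τ * ‖z‖ ^ 2) ^ m)⁻¹ = (D ^ m)⁻¹ * ((1 + ‖√(τ / D) • z‖ ^ 2) ^ m)⁻¹ := by
  rw [norm_smul, mul_pow, Real.norm_of_nonneg (Real.sqrt_nonneg _), Real.sq_sqrt (by positivity),
    ← mul_inv, ← mul_pow]
  congr 2
  field_simp

lemma integral_inv_pow_add {m : ℕ} {D τ : ℝ} (hD : 0 < D) (hτ : 0 < τ) :
    ∫ z : Fin m → ℝ, ((D + τ * ‖z‖ ^ 2) ^ m)⁻¹
      = (∫ u : Fin m → ℝ, ((1 + ‖u‖ ^ 2) ^ m)⁻¹) * (τ * D) ^ (-((m : ℝ) / 2)) := by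
  simp only [inv_pow_add_eq hD hτ]
  rw [integral_const_mul, Measure.integral_comp_smul volume
    (fun u : Fin m → ℝ => ((1 + ‖u‖ ^ 2) ^ m)⁻¹), smul_eq_mul, Module.finrank_fin_fun,
    abs_of_nonneg (by positivity)]
  have h1 : (D ^ m)⁻¹ * (√(τ / D) ^ m)⁻¹ = (τ * D) ^ (-((m : ℝ) / 2)) := by
    rw [Real.rpow_neg (by positivity), ← mul_inv, ← mul_pow]
    congr 1
    have h2 : D * √(τ / D) = √(τ * D) := by
      rw [← Real.sqrt_sq hD.le, ← Real.sqrt_mul (by positivity), Real.sqrt_sq hD.le]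
      congr 1
      field_simp
    rw [h2, Real.sqrt_eq_rpow, ← Real.rpow_natCast, ← Real.rpow_mul (by positivity)]
    congr 1
    ring
  rw [← h1]
  ring

lemma integrable_inv_pow_add {m : ℕ} (hm : 1 ≤ m) {D τ : ℝ} (hD : 0 < D) (hτ : 0 < τ) :
    Integrable fun z : Fin m → ℝ => ((D + τ * ‖z‖ ^ 2) ^ m)⁻¹ := by
  simp only [inv_pow_add_eq hD hτ]
  exact ((integrable_inv_one_add_norm_sq_pow hm).comp_smul (by positivity)).const_mul _

/-- The spherical integral of a power of `D + τ ‖ω'‖²`, where `ω'` is the part of `ω` orthogonal to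
a fixed unit vector. -/
lemma integral_sphere_inv_pow_add_le {m : ℕ} (hm : 1 ≤ m) {D τ : ℝ} (hD : 0 < D) (hτ : 0 < τ)
    {e : EuclideanSpace ℝ (Fin (m + 1))} (he : ‖e‖ = 1)
    {Z : EuclideanSpace ℝ (Fin (m + 1)) →L[ℝ] (Fin m → ℝ)}
    (hZ : MeasurePreserving fun y => ((inner ℝ e y : ℝ), Z y)) :
    ∫ ω : Metric.sphere (0 : EuclideanSpace ℝ (Fin (m + 1))) 1,
        ((D + τ * ‖Z ω‖ ^ 2) ^ m)⁻¹ ∂(volume : Measure (EuclideanSpace ℝ (Fin (m + 1)))).toSphere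
      ≤ (m + 1) * (2 * ((∫ u : Fin m → ℝ, ((1 + ‖u‖ ^ 2) ^ m)⁻¹)
          * (τ * D) ^ (-((m : ℝ) / 2)))) := by
  have hpos (z : Fin m → ℝ) : 0 < (D + τ * ‖z‖ ^ 2) ^ m := by positivity
  have hcont : Continuous fun y => ((D + τ * ‖Z y‖ ^ 2) ^ m)⁻¹ :=
    Continuous.inv₀ (by fun_prop) fun y => (hpos _).ne'
  refine (integral_sphere_le_integral_ball volume (h := fun y => ((D + τ * ‖Z y‖ ^ 2) ^ m)⁻¹)
    hcont fun ω ρ h0 h1 => ?_).trans ?_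
  · gcongr
    rw [map_smul, norm_smul, Real.norm_of_nonneg h0.le]
    exact mul_le_of_le_one_left (norm_nonneg _) h1.le
  · rw [finrank_euclideanSpace_fin]
    push_cast
    refine mul_le_mul_of_nonneg_left ?_ (by positivity)
    -- The unit ball lies in the slab `|⟨e, y⟩| ≤ 1`.
    set k : ℝ × (Fin m → ℝ) → ℝ := fun p =>
      (Icc (-1 : ℝ) 1).indicator 1 p.1 * ((D + τ * ‖p.2‖ ^ 2) ^ m)⁻¹ with hk
    have hki : Integrable k := by
      refine Integrable.mul_prod (f := (Icc (-1 : ℝ) 1).indicator 1) ?_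
        (integrable_inv_pow_add hm hD hτ)
      exact (integrable_indicator_iff measurableSet_Icc).2
        (integrableOn_const (by simp))
    have hkm : AEStronglyMeasurable k (Measure.map (fun y => ((inner ℝ e y : ℝ), Z y)) volume) := by
      rw [hZ.map_eq]
      exact hki.aestronglyMeasurable
    have hkc : Integrable fun y => k ((inner ℝ e y : ℝ), Z y) := hZ.integrable_comp_of_integrable hki
    have hkval : ∫ y, k ((inner ℝ e y : ℝ), Z y)
        = 2 * ((∫ u : Fin m → ℝ, ((1 + ‖u‖ ^ 2) ^ m)⁻¹) * (τ * D) ^ (-((m : ℝ) / 2))) := by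
      rw [← integral_map hZ.measurable.aemeasurable hkm, hZ.map_eq, hk, Measure.volume_eq_prod,
        integral_prod_mul (fun s => (Icc (-1 : ℝ) 1).indicator 1 s)
          fun z : Fin m → ℝ => ((D + τ * ‖z‖ ^ 2) ^ m)⁻¹, integral_inv_pow_add hD hτ,
        integral_indicator_one measurableSet_Icc]
      norm_num
    rw [← hkval, ← integral_indicator Metric.isOpen_ball.measurableSet]
    refine integral_mono_of_nonneg (Eventually.of_forall fun y => ?_) hkc
      (Eventually.of_forall fun y => ?_)
    · exact indicator_nonneg (fun y _ => (inv_pos.2 (hpos _)).le) y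
    · simp only [hk]
      by_cases hy : y ∈ Metric.ball (0 : EuclideanSpace ℝ (Fin (m + 1))) 1
      · have h1 := abs_real_inner_le_norm e y
        rw [he, one_mul] at h1
        have h2 : ‖y‖ < 1 := by simpa using hy
        have h3 : inner ℝ e y ∈ Icc (-1 : ℝ) 1 := abs_le.1 (h1.trans h2.le)
        rw [indicator_of_mem hy, indicator_of_mem h3, Pi.one_apply, one_mul]
      · rw [indicator_of_notMem hy]
        exact mul_nonneg (indicator_nonneg (fun _ _ => zero_le_one) _) (inv_pos.2 (hpos _)).le

/-- The elementary inequality behind the spherical estimate, with `r = |x|`, `σ = 1 - cos θ` and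
`z = ‖ω'‖²`, where `θ` is the angle between `ω` and `x` and `u = ⟨x, ω⟩ - t`. -/
lemma add_sq_le_of_cap {D r σ z t R u : ℝ} (hr : 0 ≤ r) (hR : 0 ≤ R)
    (hD : D = 1 + |t - r|) (hrt : r ≤ t + R) (hz1 : z ≤ 1) (hzσ : z ≤ 2 * σ)
    (hz0 : 0 ≤ z) (hu : u = r * (1 - σ) - t) :
    D + (1 + t) * z ≤ 2 * (1 + 2 * R) * (1 + |u|) := by
  have h1 : t - r ≤ |t - r| := le_abs_self _
  have h2 : |t - r| ≤ (t - r) + 2 * R := abs_le.2 ⟨by linarith, by linarith⟩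
  have h3 : (t - r) + r * σ ≤ |u| := by
    rw [hu]
    exact (by ring : (t - r) + r * σ = -(r * (1 - σ) - t)).le.trans (neg_le_abs _)
  have h4 : r * z ≤ 2 * (r * σ) := by nlinarith
  have h5 : D * z ≤ D := mul_le_of_le_one_right (by rw [hD]; positivity) hz1
  have h6 : (1 + t) * z ≤ (D + r) * z := mul_le_mul_of_nonneg_right (by rw [hD]; linarith) hz0
  nlinarith [abs_nonneg u, mul_nonneg hR (abs_nonneg u)]

/-- The integral over the sphere of `(1 + |⟨x, ω⟩ - t|)^{-m}` on `ℝ^{m+1}`, for `(x, t)` at distance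
at most `R` outside the light cone. For `t ≥ 0` the quantity `1 + |⟨x, ω⟩ - t|` is bounded below by a
multiple of `1 + |t - |x|| + (1 + t) ‖ω'‖²`, where `ω'` is the part of `ω` orthogonal to `x`. -/
theorem exists_integral_sphere_le {m : ℕ} (hm : 1 ≤ m) {R : ℝ} (hR : 0 ≤ R) :
    ∃ C, 0 ≤ C ∧ ∀ (x : EuclideanSpace ℝ (Fin (m + 1))) (t : ℝ), ‖x‖ ≤ |t| + R →
      ∫ ω : Metric.sphere (0 : EuclideanSpace ℝ (Fin (m + 1))) 1, ((1 + |inner ℝ x ω.1 - t|) ^ m)⁻¹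
          ∂(volume : Measure (EuclideanSpace ℝ (Fin (m + 1)))).toSphere
        ≤ C * ((1 + |t|) * (1 + |(|t| - ‖x‖)|)) ^ (-((m : ℝ) / 2)) := by
  refine ⟨(2 * (1 + 2 * R)) ^ m * ((m + 1) * (2 * ∫ u : Fin m → ℝ, ((1 + ‖u‖ ^ 2) ^ m)⁻¹)),
    ?_, fun x t hxt => ?_⟩
  · have : 0 ≤ ∫ u : Fin m → ℝ, ((1 + ‖u‖ ^ 2) ^ m)⁻¹ := integral_nonneg fun u => by positivity
    positivity
  -- Reflecting `x` reduces to positive times.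
  wlog ht : 0 ≤ t generalizing x t
  · have h := this (-x) (-t) (by simpa using hxt) (by linarith)
    rw [abs_neg, norm_neg] at h
    refine le_of_eq_of_le ?_ h
    refine integral_congr_ae (Eventually.of_forall fun ω => ?_)
    simp only
    rw [inner_neg_left, ← abs_neg]
    congr 4
    ring
  rw [abs_of_nonneg ht] at hxt ⊢
  obtain ⟨e, he, hxe⟩ : ∃ e : EuclideanSpace ℝ (Fin (m + 1)), ‖e‖ = 1 ∧ x = ‖x‖ • e := by
    rcases eq_or_ne x 0 with rfl | hx
    · exact ⟨stdVec 0, by simp [stdVec], by simp⟩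
    · exact ⟨‖x‖⁻¹ • x, by simp [norm_smul, hx], by simp [smul_smul, hx]⟩
  obtain ⟨Z, hZ, hmp⟩ := exists_orthogonal_coordinates e he
  set D := 1 + |t - ‖x‖| with hD
  have hD0 : 0 < D := by positivity
  have h1t : 0 < 1 + t := by linarith
  have hkey := integral_sphere_inv_pow_add_le hm hD0 h1t he hmp
  have hbound (ω : Metric.sphere (0 : EuclideanSpace ℝ (Fin (m + 1))) 1) :
      ((1 + |inner ℝ x ω.1 - t|) ^ m)⁻¹
        ≤ (2 * (1 + 2 * R)) ^ m * ((D + (1 + t) * ‖Z ω‖ ^ 2) ^ m)⁻¹ := by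
    have hω : ‖ω.1‖ = 1 := by simp
    have h1 : inner ℝ e ω.1 ≤ 1 := by simpa [he, hω] using real_inner_le_norm e ω.1
    have h2 := hZ ω.1
    rw [hω, one_pow] at h2
    have h3 : inner ℝ x ω.1 = ‖x‖ * (1 - (1 - inner ℝ e ω.1)) := by
      conv_lhs => rw [hxe]
      rw [real_inner_smul_left]
      ring
    have h4 := add_sq_le_of_cap (D := D) (r := ‖x‖) (σ := 1 - inner ℝ e ω.1) (z := ‖Z ω‖ ^ 2)
      (t := t) (u := inner ℝ x ω.1 - t) (norm_nonneg x) hR hD hxt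
      (by nlinarith [sq_nonneg (inner ℝ e ω.1)]) (by nlinarith [sq_nonneg (1 - inner ℝ e ω.1)])
      (sq_nonneg _) (by rw [h3])
    have h5 := pow_le_pow_left₀ (by positivity) h4 m
    rw [mul_pow] at h5
    rw [← div_eq_mul_inv, le_div_iff₀ (by positivity), inv_mul_le_iff₀ (by positivity)]
    linarith
  have hcZ : Continuous fun ω : Metric.sphere (0 : EuclideanSpace ℝ (Fin (m + 1))) 1 =>
      ((D + (1 + t) * ‖Z ω‖ ^ 2) ^ m)⁻¹ :=
    Continuous.inv₀ (by fun_prop) fun y => by positivity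
  have hcx : Continuous fun ω : Metric.sphere (0 : EuclideanSpace ℝ (Fin (m + 1))) 1 =>
      ((1 + |inner ℝ x ω.1 - t|) ^ m)⁻¹ :=
    Continuous.inv₀ (by fun_prop) fun y => by positivity
  refine (integral_mono (integrable_sphere_of_continuous volume hcx)
    ((integrable_sphere_of_continuous volume hcZ).const_mul _) hbound).trans ?_
  rw [integral_const_mul]
  refine (mul_le_mul_of_nonneg_left hkey (by positivity)).trans_eq ?_
  ring

end SphereEstimate

/-! ### Half-waves and the decay estimate -/

section HalfWave

variable {m : ℕ}

/-- The integrand `e^{2πi(⟨x, ξ⟩ + t‖ξ‖)} φ(ξ) / ‖ξ‖ ^ j` of a half-wave. Its value at `ξ = 0`, where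
the quotient is a junk value for `j = 1`, is irrelevant to the integral. -/
noncomputable def halfWave (φ : SchwartzMap (EuclideanSpace ℝ (Fin (m + 1))) ℂ) (j : ℕ)
    (x : EuclideanSpace ℝ (Fin (m + 1))) (t : ℝ) (ξ : EuclideanSpace ℝ (Fin (m + 1))) : ℂ :=
  Complex.exp ((2 * Real.pi * (inner ℝ x ξ + t * ‖ξ‖) : ℝ) * Complex.I)
    * (φ ξ / (‖ξ‖ : ℂ) ^ j)

lemma integrable_halfWave (φ : SchwartzMap (EuclideanSpace ℝ (Fin (m + 1))) ℂ) {j : ℕ}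
    (hj : j ≤ m) (x : EuclideanSpace ℝ (Fin (m + 1))) (t : ℝ) : Integrable (halfWave φ j x t) := by
  obtain ⟨A, hA⟩ : ∃ A, ∀ ξ, (1 + ‖ξ‖) ^ (m + 2) * ‖φ ξ‖ ≤ A := by
    refine ⟨2 ^ (m + 2) * ((Finset.Iic (m + 2, 0)).sup fun l => SchwartzMap.seminorm ℝ l.1 l.2) φ,
      fun ξ => ?_⟩
    simpa using φ.one_add_le_sup_seminorm_apply (𝕜 := ℝ) (m := (m + 2, 0)) le_rfl le_rfl ξ
  have hA0 : 0 ≤ A := (by positivity : (0 : ℝ) ≤ (1 + ‖(0 : EuclideanSpace ℝ (Fin (m + 1)))‖)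
    ^ (m + 2) * ‖φ 0‖).trans (hA 0)
  have hg : Integrable fun ξ : EuclideanSpace ℝ (Fin (m + 1)) =>
      A / ((1 + ‖ξ‖) ^ (m + 2) * ‖ξ‖ ^ j) := by
    refine (integrable_fun_norm_addHaar volume
      (f := fun r : ℝ => A / ((1 + r) ^ (m + 2) * r ^ j))).2 ?_
    refine Integrable.mono' (integrable_inv_one_add_sq.const_mul A).integrableOn ?_ ?_
    · exact Measurable.aestronglyMeasurable (by fun_prop)
    · refine (ae_restrict_mem measurableSet_Ioi).mono fun r (hr : 0 < r) => ?_
      rw [finrank_euclideanSpace_fin, Nat.add_sub_cancel, smul_eq_mul,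
        Real.norm_of_nonneg (by positivity), ← mul_div_assoc, ← div_eq_mul_inv,
        div_le_div_iff₀ (by positivity) (by positivity)]
      have h1 : r ^ (m - j) ≤ (1 + r) ^ m :=
        (pow_le_pow_left₀ hr.le (by linarith) _).trans
          (pow_le_pow_right₀ (by linarith) (Nat.sub_le m j))
      have h2 : r ^ m = r ^ (m - j) * r ^ j := by rw [← pow_add, Nat.sub_add_cancel hj]
      have h3 : 1 + r ^ 2 ≤ (1 + r) ^ 2 := by nlinarith
      calc r ^ m * A * (1 + r ^ 2) = A * (r ^ (m - j) * (1 + r ^ 2) * r ^ j) := by rw [h2]; ring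
        _ ≤ A * ((1 + r) ^ m * (1 + r) ^ 2 * r ^ j) := by gcongr
        _ = _ := by rw [pow_add]
  refine hg.mono' ?_ ?_
  · have := φ.continuous.measurable
    unfold halfWave
    exact Measurable.aestronglyMeasurable (by fun_prop)
  · have h0 : ∀ᵐ ξ : EuclideanSpace ℝ (Fin (m + 1)), ξ ≠ 0 := by
      simp [ae_iff, measure_singleton]
    filter_upwards [h0] with ξ hξ
    have hξ' := norm_pos_iff.2 hξ
    rw [halfWave, norm_mul, Complex.norm_exp_ofReal_mul_I, one_mul, norm_div, norm_pow,
      Complex.norm_real, norm_norm, div_le_div_iff₀ (by positivity) (by positivity)]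
    calc ‖φ ξ‖ * ((1 + ‖ξ‖) ^ (m + 2) * ‖ξ‖ ^ j)
        = ((1 + ‖ξ‖) ^ (m + 2) * ‖φ ξ‖) * ‖ξ‖ ^ j := by ring
      _ ≤ A * ‖ξ‖ ^ j := by gcongr; exact hA ξ

/-- Dispersive decay of half-waves near and inside the light cone. In polar coordinates the radial
integral carries the weight `ρ ^ (m - j)`, hence decays at least like `(1 + |⟨x, ω⟩ + t|)^{-m}`. -/
theorem exists_norm_integral_halfWave_le (φ : SchwartzMap (EuclideanSpace ℝ (Fin (m + 1))) ℂ)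
    {j : ℕ} (hm : 1 ≤ m) (hj : j ≤ 1) {R : ℝ} (hR : 0 ≤ R) :
    ∃ C, 0 ≤ C ∧ ∀ (x : EuclideanSpace ℝ (Fin (m + 1))) (t : ℝ), ‖x‖ ≤ |t| + R →
      ‖∫ ξ, halfWave φ j x t ξ‖
        ≤ C * ((1 + |t|) * (1 + |(|t| - ‖x‖)|)) ^ (-((m : ℝ) / 2)) := by
  obtain ⟨C₁, hC₁, h₁⟩ := φ.exists_norm_radial_integral_le (m - j)
  obtain ⟨C₂, hC₂, h₂⟩ := exists_integral_sphere_le hm hR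
  refine ⟨C₁ * C₂, mul_nonneg hC₁ hC₂, fun x t hxt => ?_⟩
  have hjm : j ≤ m := hj.trans hm
  rw [(integral_eq_integral_sphere volume (integrable_halfWave φ hjm x t)).2]
  have hinner (ω : Metric.sphere (0 : EuclideanSpace ℝ (Fin (m + 1))) 1) :
      ‖∫ ρ in Ioi (0 : ℝ), ρ ^ (Module.finrank ℝ (EuclideanSpace ℝ (Fin (m + 1))) - 1)
          • halfWave φ j x t (ρ • ω.1)‖ ≤ C₁ * ((1 + |inner ℝ x ω.1 - -t|) ^ m)⁻¹ := by
    have hω : ‖ω.1‖ = 1 := by simp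
    set s : ℝ := 2 * Real.pi * (inner ℝ x ω.1 + t) with hs
    have h3 : ∫ ρ in Ioi (0 : ℝ), ρ ^ (Module.finrank ℝ (EuclideanSpace ℝ (Fin (m + 1))) - 1)
          • halfWave φ j x t (ρ • ω.1)
        = ∫ ρ in Ioi (0 : ℝ), Complex.exp (ρ * s * Complex.I) * ρ ^ (m - j) * φ (ρ • ω.1) := by
      refine setIntegral_congr_fun measurableSet_Ioi fun ρ (hρ : 0 < ρ) => ?_
      have hρ' : (ρ : ℂ) ≠ 0 := by exact_mod_cast hρ.ne'
      rw [halfWave, norm_smul, hω, mul_one, Real.norm_of_nonneg hρ.le, real_inner_smul_right,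
        finrank_euclideanSpace_fin, Nat.add_sub_cancel, Complex.real_smul,
        show 2 * Real.pi * (ρ * inner ℝ x ω.1 + t * ρ) = ρ * s by rw [hs]; ring,
        pow_sub₀ _ hρ' hjm]
      push_cast
      field_simp
    rw [h3]
    refine (h₁ ω.1 hω s).trans ?_
    have h4 : |inner ℝ x ω.1 - -t| ≤ |s| := by
      rw [sub_neg_eq_add, hs, abs_mul, abs_of_pos Real.two_pi_pos]
      exact le_mul_of_one_le_left (abs_nonneg _) (by linarith [Real.two_le_pi])
    have h5 : (1 + |inner ℝ x ω.1 - -t|) ^ m ≤ (1 + |s|) ^ (m - j + 1) :=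
      (pow_le_pow_left₀ (by positivity) (by linarith) m).trans
        (pow_le_pow_right₀ (by linarith [abs_nonneg s]) (by omega))
    gcongr
  have hc : Continuous fun ω : Metric.sphere (0 : EuclideanSpace ℝ (Fin (m + 1))) 1 =>
      ((1 + |inner ℝ x ω.1 - -t|) ^ m)⁻¹ :=
    Continuous.inv₀ (by fun_prop) fun y => by positivity
  refine (norm_integral_le_of_norm_le ((integrable_sphere_of_continuous volume hc).const_mul C₁)
    (Eventually.of_forall hinner)).trans ?_
  rw [integral_const_mul, mul_assoc]
  have h6 := h₂ x (-t) (by rwa [abs_neg])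
  rw [abs_neg] at h6
  exact mul_le_mul_of_nonneg_left h6 hC₁

end HalfWave

section Decay

variable {m : ℕ} {f g : EuclideanSpace ℝ (Fin (m + 1)) → ℝ}
  {v : EuclideanSpace ℝ (Fin (m + 1)) → ℝ → ℝ}

namespace IsWaveSolution

/-- The spatial Fourier transform of a solution, multiplied by a character, as a superposition of
half-waves. -/
lemma exp_mul_fourier_eq (hv : IsWaveSolution f g v) {R : ℝ} (hf : ∀ x, R < ‖x‖ → f x = 0)
    (hg : ∀ x, R < ‖x‖ → g x = 0) {φ γ : SchwartzMap (EuclideanSpace ℝ (Fin (m + 1))) ℂ}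
    (hφ : ⇑φ = 𝓕 fun x => (f x : ℂ)) (hγ : ⇑γ = 𝓕 fun x => (g x : ℂ))
    (x : EuclideanSpace ℝ (Fin (m + 1))) (t : ℝ) :
    (fun ξ => Complex.exp ((2 * Real.pi * inner ℝ ξ x : ℝ) * Complex.I)
        * 𝓕 (fun x => (v x t : ℂ)) ξ)
      =ᵐ[volume] fun ξ => (halfWave φ 0 x t ξ + halfWave φ 0 x (-t) ξ) / 2
        + (halfWave γ 1 x t ξ - halfWave γ 1 x (-t) ξ) / (4 * Real.pi * Complex.I) := by
  have h0 : ∀ᵐ ξ : EuclideanSpace ℝ (Fin (m + 1)), ξ ≠ 0 := by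
    simp [ae_iff, measure_singleton]
  filter_upwards [h0] with ξ hξ
  have hξ' : (‖ξ‖ : ℂ) ≠ 0 := by exact_mod_cast norm_ne_zero_iff.2 hξ
  have hpi : (Real.pi : ℂ) ≠ 0 := by exact_mod_cast Real.pi_ne_zero
  have e1 (s : ℝ) : Complex.exp ((2 * Real.pi * (inner ℝ x ξ + s * ‖ξ‖) : ℝ) * Complex.I)
      = Complex.exp ((2 * Real.pi * inner ℝ ξ x : ℝ) * Complex.I)
        * Complex.exp ((2 * Real.pi * ‖ξ‖ : ℝ) * s * Complex.I) := by
    rw [← Complex.exp_add, real_inner_comm]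
    congr 1
    push_cast
    ring
  have e2 : Complex.exp ((2 * Real.pi * ‖ξ‖ : ℝ) * (-t : ℝ) * Complex.I)
      = Complex.exp (-((2 * Real.pi * ‖ξ‖ : ℝ) * t * Complex.I)) := by
    congr 1
    push_cast
    ring
  rw [hv.fourier_eq hf hg hξ t]
  simp only [halfWave, e1, e2, hφ, hγ]
  push_cast
  field_simp
  ring

/-- A solution with smooth compactly supported data as a superposition of half-waves. -/
lemma eq_integral_halfWave (hv : IsWaveSolution f g v) {R : ℝ} (hf : ∀ x, R < ‖x‖ → f x = 0)
    (hg : ∀ x, R < ‖x‖ → g x = 0) (hm : 1 ≤ m)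
    {φ γ : SchwartzMap (EuclideanSpace ℝ (Fin (m + 1))) ℂ}
    (hφ : ⇑φ = 𝓕 fun x => (f x : ℂ)) (hγ : ⇑γ = 𝓕 fun x => (g x : ℂ))
    (x : EuclideanSpace ℝ (Fin (m + 1))) (t : ℝ) :
    (v x t : ℂ) = ((∫ ξ, halfWave φ 0 x t ξ) + ∫ ξ, halfWave φ 0 x (-t) ξ) / 2
      + ((∫ ξ, halfWave γ 1 x t ξ) - ∫ ξ, halfWave γ 1 x (-t) ξ) / (4 * Real.pi * Complex.I) := by
  have iφ (y : EuclideanSpace ℝ (Fin (m + 1))) (s : ℝ) :=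
    integrable_halfWave φ (Nat.zero_le m) y s
  have iγ (y : EuclideanSpace ℝ (Fin (m + 1))) (s : ℝ) := integrable_halfWave γ hm y s
  have iadd (y : EuclideanSpace ℝ (Fin (m + 1))) := ((iφ y t).fun_add (iφ y (-t))).div_const 2
  have isub (y : EuclideanSpace ℝ (Fin (m + 1))) : Integrable fun ξ =>
      (halfWave γ 1 y t ξ - halfWave γ 1 y (-t) ξ) / (4 * Real.pi * Complex.I) :=
    ((iγ y t).sub (iγ y (-t))).div_const (4 * Real.pi * Complex.I)
  have hcont : Continuous fun y => (v y t : ℂ) := by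
    have := hv.contDiff.continuous.comp
      (by fun_prop : Continuous fun y : EuclideanSpace ℝ (Fin (m + 1)) => (y, t))
    exact Complex.continuous_ofReal.comp this
  have hint : Integrable fun y => (v y t : ℂ) :=
    integrable_of_continuous_of_support hcont (r := R + |t|) fun y hy => by
      simp [hv.eq_zero_of_lt_norm hf hg hy]
  have hF : Integrable (𝓕 fun y => (v y t : ℂ)) := by
    refine ((iadd 0).fun_add (isub 0)).congr ?_
    filter_upwards [hv.exp_mul_fourier_eq hf hg hφ hγ 0 t] with ξ hξ
    rw [← hξ]
    simp
  have hinv := congrFun (hcont.fourierInv_fourier_eq hint hF) x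
  rw [Real.fourierInv_eq'] at hinv
  simp only [smul_eq_mul] at hinv
  rw [← hinv, integral_congr_ae (hv.exp_mul_fourier_eq hf hg hφ hγ x t),
    integral_add (iadd x) (isub x), integral_div, integral_div,
    integral_add (iφ x t) (iφ x (-t)), integral_sub (iγ x t) (iγ x (-t))]

end IsWaveSolution

lemma HasCompactSupport.exists_schwartzMap_eq_fourier {E : Type*} [NormedAddCommGroup E]
    [InnerProductSpace ℝ E] [FiniteDimensional ℝ E] [MeasurableSpace E] [BorelSpace E] {h : E → ℝ}
    (hs : HasCompactSupport h) (hh : ContDiff ℝ (⊤ : ℕ∞) h) :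
    ∃ φ : SchwartzMap E ℂ, ⇑φ = 𝓕 fun x => (h x : ℂ) := by
  have h1 : HasCompactSupport fun x => (h x : ℂ) := hs.comp_left Complex.ofReal_zero
  have h2 : ContDiff ℝ (⊤ : ℕ∞) fun x => (h x : ℂ) := Complex.ofRealCLM.contDiff.comp hh
  exact ⟨𝓕 (h1.toSchwartzMap h2), SchwartzMap.fourier_coe _⟩

/-- The decay estimate with the full gain away from the light cone, in every dimension `m + 1 ≥ 2`. -/
theorem IsWaveSolution.exists_abs_le (hm : 1 ≤ m) (hf : ContDiff ℝ (⊤ : ℕ∞) f)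
    (hfs : HasCompactSupport f) (hg : ContDiff ℝ (⊤ : ℕ∞) g) (hgs : HasCompactSupport g) :
    ∃ C, 0 ≤ C ∧ ∀ v : EuclideanSpace ℝ (Fin (m + 1)) → ℝ → ℝ, IsWaveSolution f g v →
      ∀ x t, |v x t| ≤ C * ((1 + |t|) * (1 + |(|t| - ‖x‖)|)) ^ (-((m : ℝ) / 2)) := by
  obtain ⟨R, hR, hfR, hgR⟩ : ∃ R, 0 ≤ R ∧ (∀ x, R < ‖x‖ → f x = 0) ∧ ∀ x, R < ‖x‖ → g x = 0 := by
    obtain ⟨R₁, h₁⟩ := hfs.isCompact.isBounded.subset_closedBall 0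
    obtain ⟨R₂, h₂⟩ := hgs.isCompact.isBounded.subset_closedBall 0
    refine ⟨max 0 (max R₁ R₂), le_max_left _ _, fun x hx => ?_, fun x hx => ?_⟩
    · refine image_eq_zero_of_notMem_tsupport fun hmem => ?_
      have h3 : ‖x‖ ≤ R₁ := by simpa using h₁ hmem
      exact absurd hx (not_lt.2 (h3.trans ((le_max_left _ _).trans (le_max_right _ _))))
    · refine image_eq_zero_of_notMem_tsupport fun hmem => ?_
      have h3 : ‖x‖ ≤ R₂ := by simpa using h₂ hmem
      exact absurd hx (not_lt.2 (h3.trans ((le_max_right _ _).trans (le_max_right _ _))))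
  obtain ⟨φ, hφ⟩ := hfs.exists_schwartzMap_eq_fourier hf
  obtain ⟨γ, hγ⟩ := hgs.exists_schwartzMap_eq_fourier hg
  obtain ⟨C₁, hC₁, h₁⟩ := exists_norm_integral_halfWave_le φ hm zero_le_one hR
  obtain ⟨C₂, hC₂, h₂⟩ := exists_norm_integral_halfWave_le γ hm le_rfl hR
  refine ⟨C₁ + C₂, add_nonneg hC₁ hC₂, fun v hv x t => ?_⟩
  set B := ((1 + |t|) * (1 + |(|t| - ‖x‖)|)) ^ (-((m : ℝ) / 2)) with hB
  have hB0 : 0 ≤ B := by positivity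
  -- Outside the light cone the half-wave estimate is not available, but the solution vanishes.
  rcases lt_or_ge (R + |t|) ‖x‖ with hx | hx
  · rw [hv.eq_zero_of_lt_norm hfR hgR hx, abs_zero]
    positivity
  have hx1 : ‖x‖ ≤ |t| + R := by linarith
  have hx2 : ‖x‖ ≤ |(-t)| + R := by rwa [abs_neg]
  have a1 := h₁ x t hx1
  have a2 := h₁ x (-t) hx2
  have b1 := h₂ x t hx1
  have b2 := h₂ x (-t) hx2
  rw [abs_neg] at a2 b2
  rw [← Real.norm_eq_abs, ← Complex.norm_real, hv.eq_integral_halfWave hfR hgR hm hφ hγ x t]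
  have hden : ‖(4 * Real.pi * Complex.I : ℂ)‖ = 4 * Real.pi := by
    simp [abs_of_pos Real.pi_pos]
  refine (norm_add_le _ _).trans ?_
  rw [norm_div, norm_div, hden, Complex.norm_two, add_mul]
  refine add_le_add ?_ ?_
  · rw [div_le_iff₀ two_pos]
    linarith [norm_add_le (∫ ξ, halfWave φ 0 x t ξ) (∫ ξ, halfWave φ 0 x (-t) ξ)]
  · rw [div_le_iff₀ (by positivity)]
    have h3 : 0 ≤ C₂ * B := by positivity
    nlinarith [norm_sub_le (∫ ξ, halfWave γ 1 x t ξ) (∫ ξ, halfWave γ 1 x (-t) ξ), Real.two_le_pi]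

end Decay

theorem proposition3 (n : ℕ) (hn : 1 < n) (f g : EuclideanSpace ℝ (Fin n) → ℝ)
    (hf : ContDiff ℝ (⊤ : ℕ∞) f) (hf_supp : HasCompactSupport f)
    (hg : ContDiff ℝ (⊤ : ℕ∞) g) (hg_supp : HasCompactSupport g) :
    ∃ C : ℝ, ∀ v : EuclideanSpace ℝ (Fin n) → ℝ → ℝ, IsWaveSolution f g v →
      (Odd n → ∀ (x : EuclideanSpace ℝ (Fin n)) (t : ℝ),
        |v x t| ≤ C * (1 + |t|) ^ (-(((n : ℝ) - 1) / 2))) ∧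
      (Even n → ∀ (x : EuclideanSpace ℝ (Fin n)) (t : ℝ),
        |v x t| ≤ C * (1 + |t|) ^ (-(((n : ℝ) - 1) / 2))
          * (1 + |(|t| - ‖x‖)|) ^ (-(((n : ℝ) - 1) / 2))) := by
  obtain ⟨m, rfl⟩ : ∃ m, n = m + 1 := ⟨n - 1, by omega⟩
  obtain ⟨C, hC, h⟩ := IsWaveSolution.exists_abs_le (by omega) hf hf_supp hg hg_supp
  have hexp : ((m + 1 : ℕ) : ℝ) - 1 = m := by push_cast; ring
  rw [hexp]
  have hfull (v : EuclideanSpace ℝ (Fin (m + 1)) → ℝ → ℝ) (hv : IsWaveSolution f g v)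
      (x : EuclideanSpace ℝ (Fin (m + 1))) (t : ℝ) :
      |v x t| ≤ C * (1 + |t|) ^ (-((m : ℝ) / 2)) * (1 + |(|t| - ‖x‖)|) ^ (-((m : ℝ) / 2)) := by
    have := h v hv x t
    rwa [Real.mul_rpow (by positivity) (by positivity), ← mul_assoc] at this
  refine ⟨C, fun v hv => ⟨fun _ x t => (hfull v hv x t).trans ?_, fun _ => hfull v hv⟩⟩
  refine mul_le_of_le_one_right (by positivity) (Real.rpow_le_one_of_one_le_of_nonpos ?_ ?_)
  · linarith [abs_nonneg (|t| - ‖x‖)]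
  · have : (0 : ℝ) ≤ m := Nat.cast_nonneg m
    linarith
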